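/- **Definitions.** Connected schemes and spaces are non-empty. A morphism of schemes $f\colon Y\to X$ is a *covering space* (or *profinite-étale*) if $Y$ is, as an $X$-scheme, the limit of a small cofiltered diagram of finite étale $X$-schemes (equivalently, $Y=\underline{\operatorname{Spec}}\,\mathcal A$ with $\mathcal A$ a filtered colimit of quasi-coherent $\mathcal O_X$-algebras, each corresponding to a finite étale morphism). A morphism $f\colon Y\to X$ is *Yoneda trivial* if there is a set $S$ of sections of $f$ such that for every connected scheme $Z$ the map $\operatorname{Maps}(Z,X)\times S\to\operatorname{Maps}(Z,Y)$, $(g,s)\mapsto s\circ g$, is a bijection. A connected scheme is *simply connected* if each of its covering spaces is Yoneda trivial. A *universal cover* of a connected scheme $X$ is a covering space $p\colon\tilde X\to X$ with $\tilde X$ connected and simply connected. A *geometric point* of $X$ is a morphism $x\colon\operatorname{Spec}\Omega\to X$ with $\Omega$ a separably closed field (for example an algebraically closed one). A *pointed $(X,x)$-scheme* is an $X$-scheme $Y$ with a morphism $y\colon\operatorname{Spec}\Omega\to Y$ lifting $x$; morphisms of pointed $(X,x)$-schemes are morphisms of $X$-schemes compatible with the points. **Proposition.** Let $X$ be a connected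 quasicompact quasiseparated scheme. Then a universal cover $p\colon\tilde X\to X$ exists. More precisely, let $x$ be any geometric point of $X$. Then: 1. The pointed $(X,x)$-schemes $(Y,y)$ with $Y$ connected and $Y\to X$ finite étale form an inverse system: their isomorphism classes form a set, there is at most one morphism between any two of them, and, with $(Y_2,y_2)\ge (Y_1,y_1)$ if there is a morphism $(Y_2,y_2)\to(Y_1,y_1)$, this set is a directed partially ordered set. 2. The inverse limit $\tilde X=\varprojlim Y$ of this system exists in the category of schemes. With the structure morphism $p\colon\tilde X\to X$ and the geometric point $\tilde x$ of $\tilde X$ determined by the points $y$, it is a covering space of $X$, $\tilde X$ is connected, and $(\tilde X,\tilde x)$ is an initial object of the category of pointed covering spaces of $(X,x)$ (pointed $(X,x)$-schemes whose structure morphism is profinite-étale). 3. $p\colon\tilde X\to X$ is a universal cover of $X$. -/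

import Mathlib

universe u

open CategoryTheory CategoryTheory.Limits AlgebraicGeometry

namespace UnivCover

/-- A morphism of schemes is finite étale. -/
def IsFiniteEtale {X Y : Scheme.{u}} (f : Y ⟶ X) : Prop :=
  IsFinite f ∧ Etale f

/-- A morphism `f : Y ⟶ X` is profinite-étale (a covering space) if `Y` is, as an `X`-scheme, the
limit of a small cofiltered diagram of finite étale `X`-schemes. As finite morphisms are affine,
such a limit is the relative spectrum of the colimit of the corresponding quasi-coherent
`𝒪_X`-algebras. -/
def IsProfiniteEtale {X Y : Scheme.{u}} (f : Y ⟶ X) : Prop :=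
  ∃ (J : Type u) (_ : SmallCategory J) (_ : IsCofiltered J) (D : J ⥤ Over X)
    (π : (Functor.const J).obj (Over.mk f) ⟶ D),
    (∀ j, IsFiniteEtale (D.obj j).hom) ∧ Nonempty (IsLimit (Cone.mk (Over.mk f) π))

/-- A morphism `f : Y ⟶ X` is Yoneda trivial if there is a set `S` of sections of `f` such that
for every connected scheme `Z` the map `Maps(Z, X) × S → Maps(Z, Y)`, `(g, s) ↦ s ∘ g`,
is bijective. Connected schemes are non-empty. -/
def IsYonedaTrivial {X Y : Scheme.{u}} (f : Y ⟶ X) : Prop :=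
  ∃ S : Set (X ⟶ Y), (∀ s ∈ S, s ≫ f = 𝟙 X) ∧
    ∀ (Z : Scheme.{u}) [ConnectedSpace Z],
      Function.Bijective (fun q : (Z ⟶ X) × S => q.1 ≫ (q.2 : X ⟶ Y))

/-- A scheme is simply connected if it is connected and each of its covering spaces is Yoneda
trivial. -/
def IsSimplyConnected (X : Scheme.{u}) : Prop :=
  ConnectedSpace X ∧
    ∀ (Y : Scheme.{u}) (f : Y ⟶ X), IsProfiniteEtale f → IsYonedaTrivial f

/-- A universal cover is a covering space whose source is connected and simply connected. -/
structure IsUniversalCover {X X' : Scheme.{u}} (p : X' ⟶ X) : Prop where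
  isProfiniteEtale : IsProfiniteEtale p
  connectedSpace : ConnectedSpace X'
  isSimplyConnected : IsSimplyConnected X'

section Pointed

variable {X P : Scheme.{u}} (x : P ⟶ X)

/-- The category of pointed `(X, x)`-schemes, for a point `x : P ⟶ X`: the objects are
`X`-schemes `Y` with a lift `y : P ⟶ Y` of `x`, and the morphisms are the morphisms of
`X`-schemes that are compatible with these lifts. -/
abbrev PointedScheme : Type (u + 1) := Under (Over.mk x)

/-- The underlying scheme of a pointed `(X, x)`-scheme. -/
abbrev toScheme : PointedScheme x ⥤ Scheme.{u} :=
  Under.forget (Over.mk x) ⋙ Over.forget X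

/-- The structure morphism `Y ⟶ X` of a pointed `(X, x)`-scheme `(Y, y)`. -/
abbrev structureMap {x : P ⟶ X} (A : PointedScheme x) : (toScheme x).obj A ⟶ X :=
  A.right.hom

/-- Being a covering space of `X`, for pointed `(X, x)`-schemes. -/
def isPointedCover : ObjectProperty (PointedScheme x) :=
  fun A => IsProfiniteEtale (structureMap A)

/-- The category of pointed covering spaces of `(X, x)`. -/
abbrev PointedCover : Type (u + 1) := (isPointedCover x).FullSubcategory

/-- Being connected and finite étale over `X`, for pointed `(X, x)`-schemes. -/
def isConnectedFiniteEtale : ObjectProperty (PointedScheme x) :=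
  fun A => ConnectedSpace ((toScheme x).obj A) ∧ IsFiniteEtale (structureMap A)

/-- The category of pointed connected finite étale `(X, x)`-schemes. -/
abbrev PointedConnectedFiniteEtale : Type (u + 1) :=
  (isConnectedFiniteEtale x).FullSubcategory

/-- The system of all pointed connected finite étale `(X, x)`-schemes. -/
abbrev finiteEtaleSystem : PointedConnectedFiniteEtale x ⥤ PointedScheme x :=
  (isConnectedFiniteEtale x).ι

end Pointed

end UnivCover

/-! Two facts about finite étale schemes over a connected `X` carry the argument. A morphism from a
connected `X`-scheme to a finite étale one is determined by its effect on a single point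
(`hom_ext_of_connectedSpace`), and every point of a finite étale `X`-scheme lies in a connected
clopen piece that is again finite étale (`exists_connected_clopen`). Hence the pointed connected
finite étale schemes form a thin category. It is cofiltered: a fibre product of two members contains
a third, the piece through the base point. It is essentially small, since an étale `Y` is recovered
from an affine étale cover `U` and the open image of its kernel pair in `U ×[X] U`.

Finite morphisms are affine, so the limit `X̃` exists. It is connected because a clopen
decomposition of it already occurs at a finite stage (`connectedSpace_of_isLimit`). Every pointed
finite étale scheme receives a map from a member of the system, hence from `X̃`. Rigidity makes
these maps unique and compatible, so `X̃` maps uniquely to every pointed covering space.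

For simple connectedness, a finite étale `W` over `X̃` is the base change of a finite étale `W'`
over some member `Y` (`exists_finiteEtale_descent`). A geometric point `w` of `W` over `x̃` makes
`W'` a pointed finite étale `X`-scheme; the resulting map from `X̃` to `W'` lies over `Y` and gives
a section of `W` through `w` (`exists_section_through_point`). As `Ω` is separably closed, such `w`
reach the whole fibre, so the finitely many clopen images of sections exhaust `W`
(`bijective_of_sections_through_points`). Passing to limits covers all profinite-étale morphisms
(`isYonedaTrivial_of_isProfiniteEtale`). -/

namespace UnivCover

/-! ### Rigidity and connected pieces of finite étale schemes -/

section Clopen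

lemma isClosedImmersion_ι_of_isClosed {X : Scheme.{u}} (U : X.Opens) (hU : IsClosed (U : Set X)) :
    IsClosedImmersion U.ι :=
  .of_isPreimmersion _ (by simpa using hU)

/-- Two morphisms over `X` into a separated unramified `X`-scheme agree as soon as their source is
connected and they agree after restriction to some non-empty scheme. -/
lemma hom_ext_of_connectedSpace {X Y Z P : Scheme.{u}} [ConnectedSpace Z] [Nonempty P]
    (f : Y ⟶ X) [IsSeparated f] [FormallyUnramified f] [LocallyOfFiniteType f]
    (g h : Z ⟶ Y) (hgh : g ≫ f = h ≫ f) (p : P ⟶ Z) (hp : p ≫ g = p ≫ h) : g = h := by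
  let l : Z ⟶ pullback f f := pullback.lift g h hgh
  -- `e` is the equalizer of `g` and `h`. The diagonal of `f` is a closed immersion (separated) and
  -- an open immersion (unramified), so `e` has clopen image; `P` makes it non-empty.
  let e := pullback.snd (pullback.diagonal f) l
  have he : Function.Surjective e := by
    have hcl : IsClopen (Set.range e) :=
      ⟨e.isClosedEmbedding.isClosed_range, e.isOpenEmbedding.isOpen_range⟩
    have hne : (Set.range e).Nonempty := by
      let q : P ⟶ pullback (pullback.diagonal f) l :=
        pullback.lift (p ≫ g) p (by
          apply pullback.hom_ext <;> simp [l, hp, pullback.lift_fst, pullback.lift_snd])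
      exact ⟨e (q (Classical.arbitrary P)), _, rfl⟩
    exact Set.range_eq_univ.mp (hcl.eq_univ hne)
  have : Surjective e := ⟨he⟩
  have : IsIso e := isIso_of_isOpenImmersion_of_opensRange_eq_top e (by
    ext x; simp)
  rw [← cancel_epi e]
  have := pullback.condition (f := pullback.diagonal f) (g := l)
  have h1 := congr($this ≫ pullback.fst f f)
  have h2 := congr($this ≫ pullback.snd f f)
  simp only [Category.assoc, pullback.diagonal_fst, pullback.diagonal_snd, l, pullback.lift_fst,
    pullback.lift_snd] at h1 h2
  exact h1.symm.trans h2

/-- Take a clopen `V` through `y` with the fewest points in the fibre over `f y`. As `f` is open and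
closed, every non-empty clopen subset of `Y` surjects onto `X` and so meets this fibre. If a clopen
`T` through `y` did not contain `V`, then `V \ T` would meet the fibre and `V ∩ T` would contradict
minimality. -/
lemma exists_connected_clopen {X Y : Scheme.{u}} [ConnectedSpace X] (f : Y ⟶ X) [IsFinite f]
    [Etale f] (y : Y) :
    ∃ V : Y.Opens, IsClosed (V : Set Y) ∧ y ∈ V ∧ ConnectedSpace V := by
  have hfin (x : X) : (f ⁻¹' {x}).Finite := f.finite_preimage_singleton x
  have hsurj (V : Set Y) (hV : IsClopen V) (hne : V.Nonempty) : f '' V = Set.univ :=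
    IsClopen.eq_univ ⟨f.isClosedMap _ hV.1, f.isOpenMap _ hV.2⟩ (hne.image _)
  let P (n : ℕ) : Prop := ∃ V : Set Y, IsClopen V ∧ y ∈ V ∧ (V ∩ f ⁻¹' {f y}).ncard = n
  have hP : ∃ n, P n := ⟨_, Set.univ, isClopen_univ, trivial, rfl⟩
  classical
  obtain ⟨V, hV, hyV, hn⟩ := Nat.find_spec hP
  refine ⟨⟨V, hV.2⟩, hV.1, hyV, ?_⟩
  have key (T : Set Y) (hT : IsClopen T) (hyT : y ∈ T) : V ⊆ T := by
    by_contra hVT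
    obtain ⟨z, hzV, hzT⟩ := Set.not_subset.mp hVT
    have hd : IsClopen (V \ T) := hV.diff hT
    obtain ⟨w, hw, hwy⟩ : f y ∈ f '' (V \ T) := by
      rw [hsurj _ hd ⟨z, hzV, hzT⟩]; trivial
    refine Nat.find_min hP (m := (V ∩ T ∩ f ⁻¹' {f y}).ncard) ?_ ⟨_, hV.inter hT, ⟨hyV, hyT⟩, rfl⟩
    rw [← hn]
    refine Set.ncard_lt_ncard ⟨by gcongr; exact Set.inter_subset_left, fun h ↦ ?_⟩
      ((hfin _).subset Set.inter_subset_right)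
    exact hw.2 (h ⟨hw.1, hwy⟩).1.2
  refine connectedSpace_iff_clopen.mpr ⟨⟨y, hyV⟩, fun S hS ↦ ?_⟩
  have himg (S : Set V) (hS : IsClopen S) : IsClopen (Subtype.val '' S) :=
    ⟨hV.1.isClosedMap_subtype_val _ hS.1, hV.2.isOpenMap_subtype_val _ hS.2⟩
  have huniv (S : Set V) (hS : IsClopen S) (hyS : ⟨y, hyV⟩ ∈ S) : S = Set.univ := by
    refine Set.eq_univ_of_forall fun z ↦ ?_
    obtain ⟨z', hz', e⟩ := key _ (himg S hS) ⟨_, hyS, rfl⟩ z.2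
    rwa [Subtype.ext e] at hz'
  by_cases hyS : ⟨y, hyV⟩ ∈ S
  · exact .inr (huniv S hS hyS)
  · exact .inl (Set.compl_univ_iff.mp (huniv _ hS.compl hyS))

/-- A pointed finite étale scheme over a connected scheme has a connected clopen subscheme through
which the point factors. -/
lemma exists_connected_finiteEtale_of_point {X Y P : Scheme.{u}} [ConnectedSpace X]
    [ConnectedSpace P] {f : Y ⟶ X} (hf : IsFiniteEtale f) (y : P ⟶ Y) :
    ∃ (V : Scheme.{u}) (i : V ⟶ Y) (v : P ⟶ V), ConnectedSpace V ∧ IsFiniteEtale (i ≫ f) ∧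
      v ≫ i = y := by
  obtain ⟨_, _⟩ := hf
  obtain ⟨p⟩ := (inferInstance : Nonempty P)
  obtain ⟨V, hV, hpV, hc⟩ := exists_connected_clopen f (y p)
  have := isClosedImmersion_ι_of_isClosed V hV
  have hr : Set.range y ⊆ Set.range V.ι := by
    have h : y ⁻¹' (V : Set Y) = Set.univ :=
      IsClopen.eq_univ ⟨hV.preimage y.continuous, V.2.preimage y.continuous⟩ ⟨p, hpV⟩
    rintro _ ⟨q, rfl⟩
    simpa using h.ge (Set.mem_univ q)
  exact ⟨V, V.ι, IsOpenImmersion.lift V.ι y hr, hc, ⟨inferInstance, inferInstance⟩,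
    IsOpenImmersion.lift_fac _ _ _⟩

end Clopen

/-! ### Sections of finite étale morphisms and Yoneda triviality -/

section YonedaTrivial

/-- A section of a finite étale morphism is an open and closed immersion. -/
lemma isClopen_range_section {T W : Scheme.{u}} (f : W ⟶ T) [IsFinite f] [Etale f] {s : T ⟶ W}
    (hs : s ≫ f = 𝟙 T) : IsOpenImmersion s ∧ IsClopen (Set.range s) := by
  have : Etale (s ≫ f) := hs ▸ inferInstance
  have : IsClosedImmersion (s ≫ f) := hs ▸ inferInstance
  have : IsClosedImmersion s := .of_comp s f
  have : Etale s := .of_comp s f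
  have : IsOpenImmersion s := .of_flat_of_mono _
  exact ⟨inferInstance, s.isClosedEmbedding.isClosed_range, s.isOpenEmbedding.isOpen_range⟩

/-- Agreement at one topological point suffices, with no condition on residue fields: the clopen
image of `s'` contains that of `s`, so `s` factors through the open immersion `s'`, and composing
with `f` shows that the factor is the identity. -/
lemma section_eq_of_apply_eq {T W : Scheme.{u}} [ConnectedSpace T] (f : W ⟶ T) [IsFinite f]
    [Etale f] {s s' : T ⟶ W} (hs : s ≫ f = 𝟙 T) (hs' : s' ≫ f = 𝟙 T) (t : T)
    (h : s t = s' t) : s = s' := by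
  have hle {s s' : T ⟶ W} (hs' : s' ≫ f = 𝟙 T) (h : s t = s' t) : Set.range s ⊆ Set.range s' := by
    have hcl := (isClopen_range_section f hs').2.preimage s.continuous
    rintro _ ⟨q, rfl⟩
    exact (hcl.eq_univ ⟨t, t, h.symm⟩).ge (Set.mem_univ q)
  have := (isClopen_range_section f hs').1
  have hl := IsOpenImmersion.lift_fac s' s (hle hs' h)
  have : IsOpenImmersion.lift s' s (hle hs' h) = 𝟙 T := by
    have h := congr($hl ≫ f)
    rwa [Category.assoc, hs, hs', Category.comp_id] at h
  rw [← hl, this, Category.id_comp]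

lemma finite_sections {T W : Scheme.{u}} [ConnectedSpace T] (f : W ⟶ T) [IsFinite f] [Etale f] :
    Finite {s : T ⟶ W // s ≫ f = 𝟙 T} := by
  obtain ⟨t⟩ := (inferInstance : Nonempty T)
  have : Finite (f ⁻¹' {t}) := f.finite_preimage_singleton t
  refine Finite.of_injective (β := f ⁻¹' {t}) (fun s ↦ ⟨s.1 t, ?_⟩) fun s s' h ↦ ?_
  · simp [← Scheme.Hom.comp_apply, s.2]
  · exact Subtype.ext (section_eq_of_apply_eq f s.2 s'.2 t congr(($h).1))

/-- If every geometric point of `W` over the geometric point `x` of `T` lies on a section of the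
finite étale morphism `W ⟶ T`, then `W` is a disjoint union of sections. -/
theorem bijective_of_sections_through_points {T W : Scheme.{u}} [ConnectedSpace T]
    {Ω : Type u} [Field Ω] [IsSepClosed Ω] (x : Spec (CommRingCat.of Ω) ⟶ T)
    (f : W ⟶ T) (hf : IsFiniteEtale f)
    (H : ∀ w : Spec (CommRingCat.of Ω) ⟶ W, w ≫ f = x → ∃ s : T ⟶ W, s ≫ f = 𝟙 T ∧ x ≫ s = w)
    (Z : Scheme.{u}) [ConnectedSpace Z] :
    Function.Bijective
      (fun q : (Z ⟶ T) × {s : T ⟶ W | s ≫ f = 𝟙 T} => q.1 ≫ (q.2 : T ⟶ W)) := by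
  obtain ⟨_, _⟩ := hf
  refine ⟨?_, fun h ↦ ?_⟩
  · rintro ⟨g, s, hs⟩ ⟨g', s', hs'⟩ h
    simp only [Set.mem_ofPred_eq] at hs hs' h
    obtain rfl : g = g' := by simpa [hs, hs'] using congr($h ≫ f)
    obtain rfl : s = s' := hom_ext_of_connectedSpace f s s' (hs.trans hs'.symm) g h
    rfl
  let U : Set W := ⋃ s : {s : T ⟶ W // s ≫ f = 𝟙 T}, Set.range s.1
  have := finite_sections f
  have hU : IsClopen U := isClopen_iUnion_of_finite fun s ↦ (isClopen_range_section f s.2).2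
  -- A non-empty complement of the sections would be clopen, hence surject onto `T` and contain a
  -- point over the image of `x`. Over a separably closed field this point underlies a lift of `x`,
  -- through which a section passes by `H`.
  have hUtop : U = Set.univ := by
    by_contra hne
    have himg : IsClopen (f '' Uᶜ) :=
      ⟨f.isClosedMap _ hU.compl.1, f.isOpenMap _ hU.compl.2⟩
    have huniv := himg.eq_univ ((Set.nonempty_compl.mpr hne).image _)
    obtain ⟨w, hw, hwx⟩ := huniv.ge (Set.mem_univ (x default))
    obtain ⟨l, hl, rfl⟩ := Scheme.exists_fac_of_etale_of_isSepClosed f x w hwx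
    obtain ⟨s, hs, rfl⟩ := H l hl
    exact hw (Set.mem_iUnion.mpr ⟨⟨s, hs⟩, x default, rfl⟩)
  obtain ⟨z⟩ := (inferInstance : Nonempty Z)
  obtain ⟨⟨s, hs⟩, t, ht⟩ := Set.mem_iUnion.mp (hUtop.ge (Set.mem_univ (h z)))
  obtain ⟨_, hcl⟩ := isClopen_range_section f hs
  have hr : Set.range h ⊆ Set.range s := by
    rintro _ ⟨q, rfl⟩
    exact ((hcl.preimage h.continuous).eq_univ ⟨z, t, ht⟩).ge (Set.mem_univ q)
  exact ⟨(IsOpenImmersion.lift s h hr, ⟨s, hs⟩), IsOpenImmersion.lift_fac _ _ _⟩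

/-- The set of all sections works. A morphism from a connected `Z` to the limit picks one section at
each finite stage; injectivity at the stages forces these sections to be compatible, so they define
a section of the limit. -/
theorem isYonedaTrivial_of_isProfiniteEtale {T Y : Scheme.{u}} (f : Y ⟶ T)
    (hf : IsProfiniteEtale f)
    (H : ∀ (W : Scheme.{u}) (p : W ⟶ T), IsFiniteEtale p → ∀ (Z : Scheme.{u}) [ConnectedSpace Z],
      Function.Bijective
        (fun q : (Z ⟶ T) × {s : T ⟶ W | s ≫ p = 𝟙 T} => q.1 ≫ (q.2 : T ⟶ W))) :
    IsYonedaTrivial f := by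
  obtain ⟨J, _, _, D, π, hD, ⟨hlim⟩⟩ := hf
  refine ⟨{s | s ≫ f = 𝟙 T}, fun s hs ↦ hs, fun Z _ ↦ ⟨?_, ?_⟩⟩
  · rintro ⟨g, s, hs⟩ ⟨g', s', hs'⟩ h
    simp only [Set.mem_ofPred_eq] at hs hs' h
    obtain rfl : g = g' := by simpa [hs, hs'] using congr($h ≫ f)
    suffices hss : Over.homMk (U := Over.mk (𝟙 T)) (V := Over.mk f) s hs = Over.homMk s' hs' by
      simpa using congr(($hss).left)
    refine hlim.hom_ext fun j ↦ ?_
    ext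
    have hw : (π.app j).left ≫ (D.obj j).hom = f := Over.w (π.app j)
    have := @(H _ (D.obj j).hom (hD j) Z).1
      (g, ⟨s ≫ (π.app j).left, by simp [hw, hs]⟩) (g, ⟨s' ≫ (π.app j).left, by simp [hw, hs']⟩)
      (by simp [reassoc_of% h])
    simpa using this
  · intro h
    have hw (j : J) : (π.app j).left ≫ (D.obj j).hom = f := Over.w (π.app j)
    have (j : J) : ∃ s : T ⟶ (D.obj j).left, s ≫ (D.obj j).hom = 𝟙 T ∧
        (h ≫ f) ≫ s = h ≫ (π.app j).left := by
      obtain ⟨⟨g, s, hs⟩, e⟩ := (H _ (D.obj j).hom (hD j) Z).2 (h ≫ (π.app j).left)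
      simp only [Set.mem_ofPred_eq] at hs e
      obtain rfl : g = h ≫ f := by simpa [hs, hw] using congr($e ≫ (D.obj j).hom)
      exact ⟨s, hs, e⟩
    choose s hs e using this
    let c : Cone D :=
      { pt := Over.mk (𝟙 T)
        π := { app j := Over.homMk (s j) (hs j)
               naturality i j φ := by
                ext
                have := @(H _ (D.obj j).hom (hD j) Z).1
                  (h ≫ f, ⟨s i ≫ (D.map φ).left, by simp [hs]⟩) (h ≫ f, ⟨s j, hs j⟩)
                  (by
                    have := congr(($(π.naturality φ)).left)
                    simp at this
                    have he := congr($(e i) ≫ (D.map φ).left)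
                    simp only [Category.assoc] at he
                    simp only [Category.assoc, he, ← this, ← e j])
                simpa using this.symm } }
    let l := hlim.lift c
    refine ⟨(h ≫ f, ⟨l.left, (Over.w l : _)⟩), ?_⟩
    let a : Over.mk (h ≫ f) ⟶ Over.mk f := Over.homMk h
    let b : Over.mk (h ≫ f) ⟶ Over.mk f := Over.homMk ((h ≫ f) ≫ l.left) (by
      have := Over.w l
      simp [c] at this
      simp [this])
    suffices hab : b = a by simpa [a, b] using congr(($hab).left)
    refine hlim.hom_ext fun j ↦ ?_
    ext
    have := congr(($(hlim.fac c j)).left)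
    simp at this
    simp [a, b, l, c, this, ← e]

end YonedaTrivial

/-! ### Essential smallness of the system -/

section Small

instance : IsZariskiLocalAtSource (@Etale : MorphismProperty Scheme.{u}) :=
  HasRingHomProperty.instIsZariskiLocalAtSource

instance : MorphismProperty.ContainsIdentities (@Etale : MorphismProperty Scheme.{u}) :=
  ⟨fun X ↦ inferInstanceAs (Etale (𝟙 X))⟩

lemma IsFiniteEtale.compactSpace {X Y : Scheme.{u}} [CompactSpace X] {f : Y ⟶ X}
    (hf : IsFiniteEtale f) : CompactSpace Y :=
  have := hf.1
  QuasiCompact.compactSpace_of_compactSpace f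

/-- The map from the kernel pair of an `X`-morphism `π : U ⟶ Y` to `U ×[X] U`. -/
noncomputable abbrev kernelPairMap {X Y U : Scheme.{u}} (q : Y ⟶ X) (f : U ⟶ X) (π : U ⟶ Y)
    (h : π ≫ q = f) : pullback π π ⟶ pullback f f :=
  pullback.lift (pullback.fst π π) (pullback.snd π π) (by
    rw [← h, pullback.condition_assoc])

/-- The map is a base change of the diagonal of `q`, which is an open immersion for étale `q`. The
kernel pair of `π` is thus determined by an open subset of `U ×[X] U`. -/
lemma isOpenImmersion_kernelPairMap {X Y U : Scheme.{u}} (q : Y ⟶ X) [Etale q] (f : U ⟶ X)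
    (π : U ⟶ Y) (h : π ≫ q = f) : IsOpenImmersion (kernelPairMap q f π h) := by
  subst h
  have := pullback_map_diagonal_isPullback π π q
  have h2 := MorphismProperty.of_isPullback (P := @IsOpenImmersion) this inferInstance
  convert h2
  apply pullback.hom_ext <;>
    simp [kernelPairMap, pullback.lift_fst, pullback.lift_snd, pullback.map]

/-- A scheme étale over `X` is determined by an étale cover `U` of it and the image in `U ×[X] U`
of its kernel pair. -/
lemma exists_desc_of_range_kernelPairMap_eq {X Y Y' U : Scheme.{u}} {q : Y ⟶ X} {q' : Y' ⟶ X}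
    [Etale q'] {f : U ⟶ X} {π : U ⟶ Y} {π' : U ⟶ Y'} (h : π ≫ q = f)
    (h' : π' ≫ q' = f) [EffectiveEpi π]
    (hr : Set.range (kernelPairMap q f π h) = Set.range (kernelPairMap q' f π' h')) :
    ∃ u : Y ⟶ Y', π ≫ u = π' := by
  have := isOpenImmersion_kernelPairMap q' f π' h'
  refine ⟨EffectiveEpi.desc π π' fun {Z} g₁ g₂ hg ↦ ?_, EffectiveEpi.fac _ _ _⟩
  have hl : pullback.lift g₁ g₂ hg ≫ kernelPairMap q f π h =
      pullback.lift g₁ g₂ (by rw [← h, reassoc_of% hg]) := by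
    apply pullback.hom_ext <;> simp [kernelPairMap, pullback.lift_fst, pullback.lift_snd]
  have hfac := IsOpenImmersion.lift_fac (kernelPairMap q' f π' h')
    (pullback.lift g₁ g₂ (by rw [← h, reassoc_of% hg])) (by
      rw [← hr, ← hl, Scheme.Hom.comp_base, TopCat.coe_comp]
      exact Set.range_comp_subset_range _ _)
  have h₁ := congr($hfac ≫ pullback.fst f f)
  have h₂ := congr($hfac ≫ pullback.snd f f)
  simp only [Category.assoc, kernelPairMap, pullback.lift_fst, pullback.lift_snd] at h₁ h₂
  have := congr(IsOpenImmersion.lift (kernelPairMap q' f π' h')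
    (pullback.lift g₁ g₂ (by rw [← h, reassoc_of% hg])) (by
      rw [← hr, ← hl, Scheme.Hom.comp_base, TopCat.coe_comp]
      exact Set.range_comp_subset_range _ _) ≫
    $(pullback.condition (f := π') (g := π')))
  rwa [reassoc_of% h₁, reassoc_of% h₂] at this

lemma nonempty_iso_of_range_kernelPairMap_eq {X U : Scheme.{u}} {Y Y' : Over X}
    [Etale Y.hom] [Etale Y'.hom] {f : U ⟶ X} {π : U ⟶ Y.left} {π' : U ⟶ Y'.left}
    (h : π ≫ Y.hom = f) (h' : π' ≫ Y'.hom = f) [EffectiveEpi π] [EffectiveEpi π']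
    (hr : Set.range (kernelPairMap Y.hom f π h) = Set.range (kernelPairMap Y'.hom f π' h')) :
    Nonempty (Y ≅ Y') := by
  obtain ⟨u, hu⟩ := exists_desc_of_range_kernelPairMap_eq h h' hr
  obtain ⟨v, hv⟩ := exists_desc_of_range_kernelPairMap_eq h' h hr.symm
  refine ⟨Over.isoMk ⟨u, v, ?_, ?_⟩ ?_⟩
  · rw [← cancel_epi π, reassoc_of% hu, hv, Category.comp_id]
  · rw [← cancel_epi π', reassoc_of% hv, hu, Category.comp_id]
  · rw [← cancel_epi π, reassoc_of% hu, h, h']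

variable (X : Scheme.{u})

/-- Being étale over `X` with quasi-compact source. -/
def etaleCompact : ObjectProperty (Over X) :=
  fun Y ↦ Etale Y.hom ∧ CompactSpace Y.left

/-- Quasi-compactness allows a single affine cover `V`, which is then replaced by an isomorphic
object of a small model. -/
lemma exists_affineEtale_cover {X : Scheme.{u}} (Y : Over X) [Etale Y.hom]
    [CompactSpace Y.left] :
    ∃ (A : SmallModel.{u} X.AffineEtale)
      (π : Spec ((equivSmallModel X.AffineEtale).inverse.obj A).left.unop ⟶ Y.left),
      π ≫ Y.hom = ((equivSmallModel X.AffineEtale).inverse.obj A).hom ∧ Surjective π ∧ Etale π := by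
  obtain ⟨V, σ, _, _, _⟩ := Scheme.exists_hom_isAffine_of_isZariskiLocalAtSource @Etale Y.left
  let B : X.AffineEtale := Scheme.AffineEtale.mk (V.isoSpec.inv ≫ σ ≫ Y.hom)
  let e := (equivSmallModel X.AffineEtale).unitIso.app B
  let e₁ := (Scheme.AffineEtale.Spec X ⋙ Scheme.Etale.forget X).mapIso e
  let e₂ : Spec ((equivSmallModel X.AffineEtale).inverse.obj
      ((equivSmallModel X.AffineEtale).functor.obj B)).left.unop ≅ Spec Γ(V, ⊤) :=
    (Over.forget X).mapIso e₁.symm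
  have he : e₂.hom ≫ B.hom = ((equivSmallModel X.AffineEtale).inverse.obj
      ((equivSmallModel X.AffineEtale).functor.obj B)).hom := Over.w e₁.inv
  refine ⟨(equivSmallModel X.AffineEtale).functor.obj B, e₂.hom ≫ V.isoSpec.inv ≫ σ, ?_,
    inferInstance, inferInstance⟩
  rw [← he]
  simp only [Category.assoc]
  rfl

instance essentiallySmall_etaleCompact : ObjectProperty.EssentiallySmall.{u} (etaleCompact X) := by
  let S (A : SmallModel.{u} X.AffineEtale) : X.AffineEtale :=
    (equivSmallModel X.AffineEtale).inverse.obj A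
  -- An index is an affine étale `U` from a small set together with a subset of `U ×[X] U`. Each
  -- index realized by some `Y` determines it up to isomorphism, so one chosen representative per
  -- index suffices.
  let K := Σ A : SmallModel.{u} X.AffineEtale, Set ↑(pullback (S A).hom (S A).hom)
  let R (k : K) (Y : Over X) : Prop :=
    ∃ (π : Spec (S k.1).left.unop ⟶ Y.left) (h : π ≫ Y.hom = (S k.1).hom),
      Etale Y.hom ∧ Surjective π ∧ Etale π ∧
        Set.range (kernelPairMap Y.hom _ π h) = k.2
  let N := {k : K // ∃ Y, R k Y}
  refine ⟨.ofObj (fun k : N ↦ k.2.choose), inferInstance, fun Y ⟨hY, hc⟩ ↦ ?_⟩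
  obtain ⟨A, π, h, hs, he⟩ := exists_affineEtale_cover Y
  let k : N := ⟨⟨A, Set.range (kernelPairMap Y.hom _ π h)⟩, Y, π, h, hY, hs, he, rfl⟩
  refine ⟨k.2.choose, ⟨k⟩, ?_⟩
  obtain ⟨π', h', hY', hs', he', hr⟩ := k.2.choose_spec
  exact nonempty_iso_of_range_kernelPairMap_eq h h' hr.symm

/-- Pointed objects embed fully faithfully into the structured arrows from `x` to the essentially
small category of quasi-compact étale `X`-schemes. -/
instance essentiallySmall_pointedConnectedFiniteEtale [CompactSpace X] {P : Scheme.{u}}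
    (x : P ⟶ X) :
    EssentiallySmall.{u} (PointedConnectedFiniteEtale x) := by
  let F₀ : PointedConnectedFiniteEtale x ⥤ (etaleCompact X).FullSubcategory :=
    ObjectProperty.lift _ ((isConnectedFiniteEtale x).ι ⋙ Under.forget _) fun A ↦ by
      exact ⟨A.2.2.2, IsFiniteEtale.compactSpace A.2.2⟩
  let F : PointedConnectedFiniteEtale x ⥤ StructuredArrow (Over.mk x) (etaleCompact X).ι :=
    { obj A := StructuredArrow.mk (Y := F₀.obj A) A.obj.hom
      map {A B} φ := StructuredArrow.homMk (F₀.map φ) (Under.w φ.hom) }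
  have : F.Faithful := ⟨fun {A B} φ ψ h ↦ by
    have := congr(($h).right.hom)
    exact ObjectProperty.hom_ext _ (Under.UnderMorphism.ext this)⟩
  have : F.Full := ⟨fun {A B} φ ↦
    ⟨⟨Under.homMk (U := A.obj) (V := B.obj) φ.right.hom (StructuredArrow.w φ)⟩, rfl⟩⟩
  exact essentiallySmall_of_fully_faithful F

end Small

/-! ### Gluing over the affine open subsets -/

section Gluing

/-- Gluing of a relative gluing datum, stated by means of its universal property. -/
lemma exists_glued {S : Scheme.{u}} {𝒰 : S.OpenCover} [Category.{u} 𝒰.I₀] [𝒰.LocallyDirected]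
    [Small.{u} 𝒰.I₀] [Quiver.IsThin 𝒰.I₀] (d : Scheme.Cover.RelativeGluingData 𝒰) :
    ∃ (Y : Scheme.{u}) (p : Y ⟶ S) (ι : ∀ i, d.functor.obj i ⟶ Y),
      (∀ i, IsPullback (d.natTrans.app i) (ι i) (𝒰.f i) p) ∧
      (∀ {i j : 𝒰.I₀} (h : i ⟶ j), d.functor.map h ≫ ι j = ι i) ∧
      (∀ {T : Scheme.{u}} (g : ∀ i, d.functor.obj i ⟶ T)
        (_ : ∀ {i j : 𝒰.I₀} (h : i ⟶ j), d.functor.map h ≫ g j = g i),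
        ∃ l : Y ⟶ T, ∀ i, ι i ≫ l = g i) ∧
      (∀ {T : Scheme.{u}} {a b : Y ⟶ T}, (∀ i, ι i ≫ a = ι i ≫ b) → a = b) := by
  refine ⟨d.glued, d.toBase, colimit.ι d.functor, d.isPullback_natTrans_ι_toBase,
    fun h ↦ colimit.w d.functor h, fun {T} g hg ↦ ?_, fun h ↦ colimit.hom_ext h⟩
  refine ⟨colimit.desc d.functor ⟨T, { app := g, naturality := fun i j h ↦ ?_ }⟩,
    fun i ↦ colimit.ι_desc _ i⟩
  exact (hg h).trans (Category.comp_id _).symm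

/-- Gluing of schemes over the affine open subsets of `X`. -/
lemma exists_glued_affineOpens {X : Scheme.{u}} (Z : X.affineOpens → Scheme.{u})
    (q : ∀ U, Z U ⟶ U.1) (m : ∀ {U V : X.affineOpens}, U ≤ V → (Z U ⟶ Z V))
    (hid : ∀ U : X.affineOpens, m le_rfl = 𝟙 (Z U))
    (hcomp : ∀ {U V W : X.affineOpens} (h : U ≤ V) (h' : V ≤ W), m (h.trans h') = m h ≫ m h')
    (hm : ∀ {U V : X.affineOpens} (h : U ≤ V), IsPullback (m h) (q U) (q V) (X.homOfLE h)) :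
    ∃ (Y : Scheme.{u}) (p : Y ⟶ X) (ι : ∀ U, Z U ⟶ Y),
      (∀ U, IsPullback (q U) (ι U) U.1.ι p) ∧
      (∀ {T : Scheme.{u}} (g : ∀ U, Z U ⟶ T)
        (_ : ∀ {U V : X.affineOpens} (h : U ≤ V), m h ≫ g V = g U),
        ∃ l : Y ⟶ T, ∀ U, ι U ≫ l = g U) ∧
      (∀ {T : Scheme.{u}} {a b : Y ⟶ T}, (∀ U, ι U ≫ a = ι U ≫ b) → a = b) := by
  have : Small.{u} X.directedAffineCover.I₀ := inferInstanceAs (Small.{u} X.affineOpens)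
  let d : X.directedAffineCover.RelativeGluingData :=
    { functor :=
        { obj := Z
          map h := m h.le
          map_id := hid
          map_comp h k := hcomp h.le k.le }
      natTrans :=
        { app := q
          naturality U V h := (hm h.le).w }
      equifibered U V h := hm h.le }
  obtain ⟨Y, p, ι, h₁, -, h₃, h₄⟩ := exists_glued d
  exact ⟨Y, p, ι, h₁, fun g hg ↦ h₃ g fun h ↦ hg h.le, h₄⟩

end Gluing

/-! ### Cofiltered limits of affine `X`-schemes -/

section AffineLimit

/-- The diagram is isomorphic to `Spec` of its global sections, and `Spec` preserves limits. -/
lemma hasLimit_of_isAffine {J : Type u} [SmallCategory J] (E : J ⥤ Scheme.{u})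
    [∀ j, IsAffine (E.obj j)] : HasLimit E := by
  let α : E ⟶ (E ⋙ Scheme.Γ.rightOp) ⋙ Scheme.Spec :=
    Functor.whiskerLeft E ΓSpec.adjunction.unit
  have : ∀ j, IsIso (α.app j) := fun j ↦
    inferInstanceAs (IsIso (ΓSpec.adjunction.unit.app (E.obj j)))
  have : IsIso α := NatIso.isIso_of_isIso_app α
  have : HasLimit ((E ⋙ Scheme.Γ.rightOp) ⋙ Scheme.Spec) :=
    ⟨⟨_, isLimitOfPreserves Scheme.Spec (limit.isLimit _)⟩⟩
  exact hasLimit_of_iso (asIso α).symm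

variable {J : Type u} [SmallCategory J] {X : Scheme.{u}} (D : J ⥤ Over X)

/-- The structure morphism of a member of a diagram of `X`-schemes. -/
abbrev diagramHom (j : J) : (D.obj j).left ⟶ X := (D.obj j).hom

lemma diagramHom_w {i j : J} (φ : i ⟶ j) : (D.map φ).left ≫ diagramHom D j = diagramHom D i :=
  Over.w (D.map φ)

/-- The limit of the restriction to an open subset `U` of `X` of a diagram of `X`-schemes. -/
structure RestrictedLimit (U : X.Opens) where
  /-- The limit. -/
  pt : Scheme.{u}
  /-- Its structure morphism. -/
  hom : pt ⟶ U
  /-- The projections. -/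
  π (j : J) : pt ⟶ (D.obj j).left
  w {i j : J} (φ : i ⟶ j) : π i ≫ (D.map φ).left = π j
  π_hom (j : J) : π j ≫ diagramHom D j = hom ≫ U.ι
  exists_lift {T : Scheme.{u}} (b : T ⟶ U) (g : ∀ j, T ⟶ (D.obj j).left)
    (hg : ∀ {i j : J} (φ : i ⟶ j), g i ≫ (D.map φ).left = g j)
    (hb : ∀ j, g j ≫ diagramHom D j = b ≫ U.ι) : ∃ l : T ⟶ pt, ∀ j, l ≫ π j = g j
  hom_ext {T : Scheme.{u}} {a b : T ⟶ pt} (h : ∀ j, a ≫ π j = b ≫ π j) : a = b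

/-- The parts of the `D.obj j` above an affine `U` are affine, so their limit exists. Its morphism
to `U` is defined through an arbitrary index `j₀`; cofilteredness makes the choice immaterial. -/
lemma nonempty_restrictedLimit [IsCofiltered J] [∀ j, IsAffineHom (diagramHom D j)]
    (U : X.affineOpens) : Nonempty (RestrictedLimit D U.1) := by
  let E : J ⥤ Scheme.{u} :=
    { obj j := (diagramHom D j ⁻¹ᵁ U.1 : (D.obj j).left.Opens)
      map {i j} φ := (D.map φ).left.resLE _ _ (by
        rw [← Scheme.Hom.comp_preimage, diagramHom_w])
      map_id j := by
        rw [← cancel_mono (Scheme.Opens.ι _)]; simp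
      map_comp φ ψ := by
        rw [← cancel_mono (Scheme.Opens.ι _)]; simp }
  have (j : J) : IsAffine (E.obj j) := U.2.preimage (diagramHom D j)
  have := hasLimit_of_isAffine E
  let π (j : J) : limit E ⟶ (D.obj j).left := limit.π E j ≫ (diagramHom D j ⁻¹ᵁ U.1).ι
  have w {i j : J} (φ : i ⟶ j) : π i ≫ (D.map φ).left = π j := by
    simp only [π, ← limit.w E φ, Category.assoc]
    congr 1
    exact (Scheme.Hom.resLE_comp_ι _ _).symm
  have hw {i j : J} (φ : i ⟶ j) : π i ≫ diagramHom D i = π j ≫ diagramHom D j := by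
    rw [← diagramHom_w D φ, ← Category.assoc, w]
  let j₀ := (IsCofiltered.nonempty (C := J)).some
  exact ⟨{
    pt := limit E
    hom := limit.π E j₀ ≫ diagramHom D j₀ ∣_ U.1
    π := π
    w := w
    π_hom j := by
      obtain ⟨k, a, b, -⟩ := IsCofilteredOrEmpty.cone_objs j j₀
      rw [← hw a, hw b]
      simp [π]
    exists_lift {T} b g hg hb := by
      let l (j : J) : T ⟶ (diagramHom D j ⁻¹ᵁ U.1 : (D.obj j).left.Opens) :=
        (isPullback_morphismRestrict (diagramHom D j) U.1).lift b (g j) (hb j).symm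
      have hl (j : J) : l j ≫ Scheme.Opens.ι _ = g j := IsPullback.lift_snd _ _ _ _
      let c : Cone E :=
        { pt := T
          π := { app := l
                 naturality i j φ := by
                  rw [← cancel_mono (Scheme.Opens.ι _)]
                  simp [E, hl, reassoc_of% hl, hg] } }
      refine ⟨limit.lift E c, fun j ↦ ?_⟩
      rw [← hl j]
      exact limit.lift_π_assoc c j _
    hom_ext {T a b} h := by
      refine limit.hom_ext fun j ↦ ?_
      rw [← cancel_mono (diagramHom D j ⁻¹ᵁ U.1).ι]
      simpa [π] using h j }⟩

namespace RestrictedLimit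

variable {D} {U V : X.Opens}

lemma exists_map (A : RestrictedLimit D U) (B : RestrictedLimit D V) (h : U ≤ V) :
    ∃ l : A.pt ⟶ B.pt, ∀ j, l ≫ B.π j = A.π j :=
  B.exists_lift (A.hom ≫ X.homOfLE h) A.π A.w fun j ↦ by simp [A.π_hom]

/-- The transition maps between the restricted limits. -/
noncomputable def map (A : RestrictedLimit D U) (B : RestrictedLimit D V) (h : U ≤ V) :
    A.pt ⟶ B.pt :=
  (exists_map A B h).choose

@[simp]
lemma map_π (A : RestrictedLimit D U) (B : RestrictedLimit D V) (h : U ≤ V) (j : J) :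
    map A B h ≫ B.π j = A.π j :=
  (exists_map A B h).choose_spec j

lemma comp_hom_eq [IsCofiltered J] (A : RestrictedLimit D U) {T : Scheme.{u}}
    {l : T ⟶ A.pt} {b : T ⟶ U}
    {g : ∀ j, T ⟶ (D.obj j).left} (hb : ∀ j, g j ≫ diagramHom D j = b ≫ U.ι)
    (h : ∀ j, l ≫ A.π j = g j) : l ≫ A.hom = b := by
  let j₀ := (IsCofiltered.nonempty (C := J)).some
  rw [← cancel_mono U.ι, ← hb j₀, ← h j₀, Category.assoc, Category.assoc, A.π_hom]

lemma map_hom [IsCofiltered J] (A : RestrictedLimit D U) (B : RestrictedLimit D V) (h : U ≤ V) :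
    map A B h ≫ B.hom = A.hom ≫ X.homOfLE h :=
  comp_hom_eq B (fun j ↦ by simp [A.π_hom]) (map_π A B h)

lemma isPullback_map [IsCofiltered J] (A : RestrictedLimit D U) (B : RestrictedLimit D V)
    (h : U ≤ V) :
    IsPullback (map A B h) A.hom B.hom (X.homOfLE h) := by
  have hs (s : PullbackCone B.hom (X.homOfLE h)) (j : J) :
      (s.fst ≫ B.π j) ≫ diagramHom D j = s.snd ≫ U.ι := by
    have := congr($s.condition ≫ V.ι)
    simpa [B.π_hom] using this
  have key (s : PullbackCone B.hom (X.homOfLE h)) :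
      ∃ l : s.pt ⟶ A.pt, ∀ j, l ≫ A.π j = s.fst ≫ B.π j :=
    A.exists_lift s.snd (fun j ↦ s.fst ≫ B.π j) (by simp [B.w]) (hs s)
  choose l hl using key
  refine ⟨⟨map_hom A B h⟩, ⟨PullbackCone.IsLimit.mk _ l ?_ ?_ ?_⟩⟩
  · exact fun s ↦ B.hom_ext fun j ↦ by simpa using hl s j
  · exact fun s ↦ comp_hom_eq A (hs s) (hl s)
  · intro s m hm _
    refine A.hom_ext fun j ↦ ?_
    rw [hl s j, ← hm]
    simp

end RestrictedLimit

variable [IsCofiltered J] [∀ j, IsAffineHom (diagramHom D j)]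

/-- The limit of a cofiltered diagram of affine `X`-schemes, glued from the limits over the
affine open subsets of `X`. -/
lemma exists_affineLimit : ∃ (Y : Scheme.{u}) (p : Y ⟶ X) (π : ∀ j, Y ⟶ (D.obj j).left),
    (∀ j, π j ≫ diagramHom D j = p) ∧
    (∀ {i j : J} (φ : i ⟶ j), π i ≫ (D.map φ).left = π j) ∧
    (∀ {T : Scheme.{u}} {a b : T ⟶ Y}, (∀ j, a ≫ π j = b ≫ π j) → a = b) ∧
    (∀ {T : Scheme.{u}} (f : T ⟶ X) (g : ∀ j, T ⟶ (D.obj j).left)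
      (_ : ∀ j, g j ≫ diagramHom D j = f)
      (_ : ∀ {i j : J} (φ : i ⟶ j), g i ≫ (D.map φ).left = g j),
      ∃ l : T ⟶ Y, ∀ j, l ≫ π j = g j) := by
  let A (U : X.affineOpens) : RestrictedLimit D U.1 := (nonempty_restrictedLimit D U).some
  let j₀ := (IsCofiltered.nonempty (C := J)).some
  obtain ⟨Y, p, ι, hP, hl, hext⟩ := exists_glued_affineOpens (fun U ↦ (A U).pt)
    (fun U ↦ (A U).hom) (fun {U V} h ↦ (A U).map (A V) h)
    (fun U ↦ RestrictedLimit.hom_ext _ fun j ↦ by simp)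
    (fun h k ↦ RestrictedLimit.hom_ext _ fun j ↦ by simp)
    (fun {U V} h ↦ (A U).isPullback_map (A V) h)
  have (j : J) := hl (fun U ↦ (A U).π j) fun h ↦ RestrictedLimit.map_π _ _ h j
  choose π hπ using this
  have hπp (j : J) : π j ≫ diagramHom D j = p := hext fun U ↦ by
    rw [reassoc_of% hπ j U, (A U).π_hom, (hP U).w]
  have hπext {T : Scheme.{u}} {a b : T ⟶ Y} (h : ∀ j, a ≫ π j = b ≫ π j) : a = b := by
    have hab : a ≫ p = b ≫ p := by rw [← hπp j₀, reassoc_of% h]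
    -- Equality is tested over each affine open `U` of `X`, where both morphisms factor through the
    -- restricted limit `(A U).pt` and its own uniqueness applies.
    let 𝒯 : T.OpenCover := X.directedAffineCover.pullback₁ (a ≫ p)
    refine Scheme.Cover.hom_ext 𝒯 _ _ fun (U : X.affineOpens) ↦ ?_
    change pullback.fst (a ≫ p) U.1.ι ≫ a = pullback.fst (a ≫ p) U.1.ι ≫ b
    have hc : pullback.snd (a ≫ p) U.1.ι ≫ U.1.ι = pullback.fst (a ≫ p) U.1.ι ≫ a ≫ p :=
      pullback.condition.symm
    have hc' : pullback.snd (a ≫ p) U.1.ι ≫ U.1.ι = pullback.fst (a ≫ p) U.1.ι ≫ b ≫ p := by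
      rw [← hab]; exact hc
    have e := (hP U).lift_snd _ _ (hc.trans (Category.assoc _ _ _).symm)
    have e' := (hP U).lift_snd _ _ (hc'.trans (Category.assoc _ _ _).symm)
    rw [← e, ← e']
    congr 1
    refine (A U).hom_ext fun j ↦ ?_
    rw [← hπ, reassoc_of% e, reassoc_of% e', h]
  refine ⟨Y, p, π, hπp, fun φ ↦ hext fun U ↦ ?_, hπext, fun {T} f g hf hg ↦ ?_⟩
  · rw [reassoc_of% hπ _ U, hπ, (A U).w]
  · let 𝒮 : T.OpenCover := X.directedAffineCover.pullback₁ f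
    have (U : X.affineOpens) : ∃ l : pullback f U.1.ι ⟶ Y,
        ∀ j, l ≫ π j = pullback.fst f U.1.ι ≫ g j := by
      obtain ⟨l, hl⟩ := (A U).exists_lift (pullback.snd f U.1.ι)
        (fun j ↦ pullback.fst f U.1.ι ≫ g j) (fun φ ↦ by rw [Category.assoc, hg])
        (fun j ↦ by rw [Category.assoc, hf, pullback.condition])
      exact ⟨l ≫ ι U, fun j ↦ by rw [Category.assoc, hπ, hl]⟩
    choose l₀ hl₀ using this
    obtain ⟨l, hl⟩ : ∃ l : ∀ U, 𝒮.X U ⟶ Y, ∀ U j, l U ≫ π j = 𝒮.f U ≫ g j := ⟨l₀, hl₀⟩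
    refine ⟨𝒮.glueMorphisms l fun U V ↦ hπext fun j ↦ ?_, fun j ↦ ?_⟩
    · rw [Category.assoc, Category.assoc, hl, hl]
      exact pullback.condition_assoc _
    · refine Scheme.Cover.hom_ext 𝒮 _ _ fun U ↦ ?_
      rw [Scheme.Cover.ι_glueMorphisms_assoc, hl]

instance hasLimit_of_isAffineHom : HasLimit D := by
  obtain ⟨Y, p, π, hp, hw, hext, hl⟩ := exists_affineLimit D
  let c : Cone D :=
    { pt := Over.mk p
      π := { app j := Over.homMk (π j) (hp j)
             naturality i j φ := by
              ext
              simpa using (hw φ).symm } }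
  have (s : Cone D) := hl s.pt.hom (fun j ↦ (s.π.app j).left) (fun j ↦ Over.w (s.π.app j))
    (fun φ ↦ by simp [← Over.comp_left])
  choose l hl using this
  exact ⟨⟨c, ⟨fun s ↦ Over.homMk (l s) (by
        let j₀ := (IsCofiltered.nonempty (C := J)).some
        change _ ≫ p = _
        rw [← hp j₀, reassoc_of% hl s j₀]
        exact Over.w (s.π.app j₀)),
      fun s j ↦ by
        ext
        exact hl s j,
      fun s m hm ↦ by
        ext
        refine hext fun j ↦ ?_
        exact congr(($(hm j)).left).trans (hl s j).symm⟩⟩⟩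

end AffineLimit

/-! ### Descent of finite étale morphisms with affine target -/

section Algebra

open TensorProduct

/-- A finite étale algebra is defined over a finitely generated subring of the base. -/
lemma exists_subalgebra_finite_etale (A B : Type u) [CommRing A] [CommRing B] [Algebra A B]
    [Module.Finite A B] [Algebra.Etale A B] :
    ∃ (A₁ : Subalgebra ℤ A) (B₁ : Type u) (_ : CommRing B₁) (_ : Algebra A₁ B₁),
      A₁.FG ∧ Module.Finite A₁ B₁ ∧ Algebra.Etale A₁ B₁ ∧ Nonempty (B ≃ₐ[A] A ⊗[A₁] B₁) := by
  obtain ⟨A₀, B₀, _, _, hA₀, _, ⟨e⟩⟩ := Algebra.Etale.exists_subalgebra_fg ℤ A B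
  obtain ⟨s, hs⟩ := (inferInstance : Algebra.FiniteType A₀ B₀).out
  have : Module.Finite A (A ⊗[A₀] B₀) := Module.Finite.equiv e.toLinearEquiv
  have hint (b : B₀) : IsIntegral A ((1 : A) ⊗ₜ[A₀] b) := Algebra.IsIntegral.isIntegral _
  choose p hpm hp using hint
  -- The étale descent `B₀` over `A₀` need not be finite. Enlarging `A₀` by the coefficients of
  -- integral equations of the generators of `B₀` repairs this.
  let t : Set A := ⋃ b ∈ s, ((p b).coeffs : Set A)
  have ht : t.Finite := s.finite_toSet.biUnion fun b _ ↦ (p b).coeffs.finite_toSet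
  let A₁ : Subalgebra ℤ A := A₀ ⊔ Algebra.adjoin ℤ t
  let : Algebra A₀ A₁ := (Subalgebra.inclusion (le_sup_left : A₀ ≤ A₁)).toAlgebra
  have : IsScalarTower A₀ A₁ A := .of_algebraMap_eq' rfl
  refine ⟨A₁, A₁ ⊗[A₀] B₀, inferInstance, inferInstance, ?_, ?_, inferInstance,
    ⟨e.trans (Algebra.TensorProduct.cancelBaseChange A₀ A₁ A A B₀).symm⟩⟩
  · exact hA₀.sup ⟨ht.toFinset, by simp⟩
  · let ψ : A₁ ⊗[A₀] B₀ →ₐ[A₁] A ⊗[A₀] B₀ :=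
      Algebra.TensorProduct.map (Algebra.ofId A₁ A) (AlgHom.id A₀ B₀)
    -- `B₀` is flat over `A₀`, so the integral equations, known over `A`, already hold over `A₁`.
    have hψ : Function.Injective ψ := by
      have := Module.Flat.rTensor_preserves_injective_linearMap (M := B₀)
        ((Algebra.ofId A₁ A).toLinearMap.restrictScalars A₀) (Subtype.val_injective)
      exact this
    have hint (b : B₀) (hb : b ∈ s) : IsIntegral A₁ ((1 : A₁) ⊗ₜ[A₀] b) := by
      have hl : p b ∈ Polynomial.lifts (algebraMap A₁ A) := by
        rw [Polynomial.lifts_iff_coeffs_subset_range]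
        intro c hc
        exact ⟨⟨c, le_sup_right (a := A₀) (Algebra.subset_adjoin (Set.mem_biUnion hb hc))⟩, rfl⟩
      obtain ⟨q, hq, -, hqm⟩ := Polynomial.lifts_and_natDegree_eq_and_monic hl (hpm b)
      refine ⟨q, hqm, hψ ?_⟩
      have h1 : ψ ((1 : A₁) ⊗ₜ[A₀] b) = (1 : A) ⊗ₜ[A₀] b :=
        (Algebra.TensorProduct.map_tmul ..).trans (by rw [map_one]; rfl)
      have h2 := hp b
      rw [← Polynomial.aeval_def] at h2 ⊢
      rw [map_zero, ← Polynomial.aeval_algHom_apply, h1, ← h2, ← hq,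
        Polynomial.aeval_map_algebraMap]
    have hadj : Algebra.adjoin A₁ ((fun b : B₀ ↦ (1 : A₁) ⊗ₜ[A₀] b) '' s) = ⊤ := by
      exact Algebra.TensorProduct.adjoin_one_tmul_image_eq_top _ hs
    have : Algebra.IsIntegral A₁ (A₁ ⊗[A₀] B₀) := by
      rw [← integralClosure_eq_top_iff, ← top_le_iff, ← hadj]
      refine Algebra.adjoin_le ?_
      rintro _ ⟨b, hb, rfl⟩
      exact hint b hb
    exact Algebra.IsIntegral.finite

end Algebra

section Affine

lemma IsFiniteEtale.of_isPullback {X Y S W : Scheme.{u}} {q : Y ⟶ W} {f : Y ⟶ X} {w : W ⟶ S}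
    {g : X ⟶ S} (h : IsPullback q f w g) (hw : IsFiniteEtale w) : IsFiniteEtale f :=
  ⟨MorphismProperty.of_isPullback (P := @IsFinite) h hw.1,
    MorphismProperty.of_isPullback (P := @Etale) h hw.2⟩

lemma IsFiniteEtale.comp {X Y Z : Scheme.{u}} {g : Z ⟶ Y} {f : Y ⟶ X} (hg : IsFiniteEtale g)
    (hf : IsFiniteEtale f) : IsFiniteEtale (g ≫ f) := by
  obtain ⟨_, _⟩ := hg
  obtain ⟨_, _⟩ := hf
  exact ⟨inferInstance, inferInstance⟩

lemma IsFiniteEtale.of_isIso {X Y : Scheme.{u}} (f : Y ⟶ X) [IsIso f] : IsFiniteEtale f :=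
  ⟨inferInstance, inferInstance⟩

open TensorProduct in
/-- A finite étale morphism to an affine scheme is a base change of a finite étale morphism to an
affine scheme of finite presentation over `ℤ`. -/
lemma exists_finiteEtale_model_of_isAffine {X Y : Scheme.{u}} [IsAffine X] (f : Y ⟶ X)
    (hf : IsFiniteEtale f) :
    ∃ (S W : Scheme.{u}) (w : W ⟶ S) (q : Y ⟶ W) (g : X ⟶ S),
      LocallyOfFinitePresentation (specULiftZIsTerminal.from S) ∧ IsFiniteEtale w ∧
        IsPullback q f w g := by
  obtain ⟨_, _⟩ := id hf
  have : IsAffine Y := isAffine_of_isAffineHom f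
  have hnat : f ≫ X.isoSpec.hom = Y.isoSpec.hom ≫ Spec.map f.appTop :=
    (Scheme.isoSpec_hom_naturality f).symm
  have hS : IsFiniteEtale (Spec.map f.appTop) := by
    have : Spec.map f.appTop = Y.isoSpec.inv ≫ f ≫ X.isoSpec.hom := by simp [hnat]
    rw [this]
    exact ⟨inferInstance, inferInstance⟩
  let : Algebra Γ(X, ⊤) Γ(Y, ⊤) := f.appTop.hom.toAlgebra
  have : Module.Finite Γ(X, ⊤) Γ(Y, ⊤) := (IsFinite.SpecMap_iff _).mp hS.1
  have : Algebra.Etale Γ(X, ⊤) Γ(Y, ⊤) := (HasRingHomProperty.Spec_iff (P := @Etale)).mp hS.2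
  obtain ⟨A₁, B₁, _, _, hA₁, _, _, ⟨e⟩⟩ := exists_subalgebra_finite_etale Γ(X, ⊤) Γ(Y, ⊤)
  let α : Y ⟶ Spec (.of (Γ(X, ⊤) ⊗[A₁] B₁)) :=
    Y.isoSpec.hom ≫ Spec.map (CommRingCat.ofHom e.symm.toRingEquiv.toRingHom)
  have : IsIso (CommRingCat.ofHom e.symm.toRingEquiv.toRingHom) :=
    inferInstanceAs (IsIso e.symm.toRingEquiv.toCommRingCatIso.hom)
  have hα : α ≫ Spec.map (CommRingCat.ofHom Algebra.TensorProduct.includeLeftRingHom) =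
      f ≫ X.isoSpec.hom := by
    rw [hnat, Category.assoc, ← Spec.map_comp]
    congr 2
    ext a
    exact e.symm.commutes a
  refine ⟨Spec (.of A₁), Spec (.of B₁), Spec.map (CommRingCat.ofHom (algebraMap A₁ B₁)), _, _,
    ?_, ⟨?_, ?_⟩,
    (IsPullback.of_horiz_isIso ⟨hα⟩).paste_horiz (isPullback_SpecMap_of_isPushout _ _ _ _
      (CommRingCat.isPushout_tensorProduct A₁ Γ(X, ⊤) B₁)).flip⟩
  · let φ : ULift.{u} ℤ →+* A₁ := (Int.castRingHom A₁).comp ULift.ringEquiv.toRingHom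
    have : specULiftZIsTerminal.from (Spec (.of A₁)) = Spec.map (CommRingCat.ofHom φ) :=
      specULiftZIsTerminal.hom_ext _ _
    rw [this, LocallyOfFinitePresentation.SpecMap_iff]
    refine RingHom.FinitePresentation.comp ?_ (.of_bijective ULift.ringEquiv.bijective)
    rw [← RingHom.FinitePresentation.of_finiteType]
    have : Algebra.FiniteType ℤ A₁ := (Subalgebra.fg_iff_finiteType A₁).mp hA₁
    have h := RingHom.finiteType_algebraMap.mpr this
    exact h
  · exact (IsFinite.SpecMap_iff _).mpr (RingHom.finite_algebraMap.mpr inferInstance)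
  · exact (HasRingHomProperty.Spec_iff (P := @Etale)).mpr
      (RingHom.etale_algebraMap.mpr inferInstance)

variable {I : Type u} [SmallCategory I] [IsCofiltered I] (D : I ⥤ Scheme.{u})
  [∀ {i j} (φ : i ⟶ j), IsAffineHom (D.map φ)] [∀ i, CompactSpace (D.obj i)]
  [∀ i, QuasiSeparatedSpace (D.obj i)] {c : Cone D} (hc : IsLimit c)

include hc in
-- The model of `f` lives over a base of finite presentation over `ℤ`, so the morphism from `c.pt`
-- to that base factors through some `D.obj i`. Pulling the model back to this stage gives the
-- descent.
lemma exists_finiteEtale_descent_of_isAffine [IsAffine c.pt] {Y : Scheme.{u}} (f : Y ⟶ c.pt)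
    (hf : IsFiniteEtale f) :
    ∃ (i : I) (W : Scheme.{u}) (w : W ⟶ D.obj i) (q : Y ⟶ W), IsFiniteEtale w ∧
      IsPullback q f w (c.π.app i) := by
  obtain ⟨S, W, w, q, g, _, hw, hq⟩ := exists_finiteEtale_model_of_isAffine f hf
  let t : D ⟶ (Functor.const I).obj (Spec (.of (ULift.{u} ℤ))) :=
    { app i := specULiftZIsTerminal.from _
      naturality i j φ := specULiftZIsTerminal.hom_ext _ _ }
  obtain ⟨i, g', hg, -⟩ := Scheme.exists_π_app_comp_eq_of_locallyOfFinitePresentation D t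
    (specULiftZIsTerminal.from S) c hc g (by ext i; exact specULiftZIsTerminal.hom_ext _ _)
  have hP := (IsPullback.of_hasPullback w g').flip
  refine ⟨i, _, pullback.snd w g', pullback.lift q (f ≫ c.π.app i) ?_,
    .of_isPullback hP.flip hw, ?_⟩
  · rw [Category.assoc, hg, hq.w]
  · refine IsPullback.of_right (h₁₂ := pullback.fst w g') (v₁₃ := w) (h₂₂ := g') ?_ ?_ hP.flip
    · subst hg
      rw [pullback.lift_fst]
      exact hq
    · exact pullback.lift_snd _ _ _

end Affine

/-! ### Descent of morphisms and isomorphisms to a finite stage -/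

section HomDescent

variable {I : Type u} [SmallCategory I] [IsCofiltered I] (D : I ⥤ Scheme.{u})
  {c : Cone D} (hc : IsLimit c)

attribute [local instance] IsCofiltered.isConnected

include hc in
/-- The base change of a cofiltered limit is the limit of the base changes. -/
lemma exists_baseChangeDiagram {j : I} {Y W : Scheme.{u}} {w : W ⟶ D.obj j} {q : Y ⟶ W}
    {y : Y ⟶ c.pt} (hq : IsPullback y q (c.π.app j) w) :
    ∃ (E : Over j ⥤ Scheme.{u}) (a : ∀ k : Over j, E.obj k ⟶ D.obj k.left)
      (b : ∀ k : Over j, E.obj k ⟶ W) (π : (Functor.const (Over j)).obj Y ⟶ E),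
      (∀ k : Over j, IsPullback (a k) (b k) (D.map (show k.left ⟶ j from k.hom)) w) ∧
      (∀ {k l : Over j} (φ : k ⟶ l), E.map φ ≫ a l = a k ≫ D.map φ.left) ∧
      (∀ {k l : Over j} (φ : k ⟶ l), E.map φ ≫ b l = b k) ∧
      (∀ k, π.app k ≫ a k = y ≫ c.π.app k.left) ∧ (∀ k, π.app k ≫ b k = q) ∧
      Nonempty (IsLimit (Cone.mk Y π)) := by
  let h (k : Over j) : k.left ⟶ j := k.hom
  let G := Over.post D ⋙ Over.pullback w
  let E : Over j ⥤ Scheme.{u} := G ⋙ Over.forget _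
  let a (k : Over j) : E.obj k ⟶ D.obj k.left := pullback.fst (D.map (h k)) w
  let b (k : Over j) : E.obj k ⟶ W := pullback.snd (D.map (h k)) w
  have hb {k l : Over j} (φ : k ⟶ l) : E.map φ ≫ b l = b k := Over.w (G.map φ)
  have ha {k l : Over j} (φ : k ⟶ l) : E.map φ ≫ a l = a k ≫ D.map φ.left :=
    pullback.lift_fst _ _ _
  let c' : Cone E := (Over.pullback w ⋙ Over.forget _).mapCone ((Over.conePost D j).obj c)
  have hc' : IsLimit c' :=
    isLimitOfPreserves (Over.pullback w ⋙ Over.forget _) (Over.isLimitConePost _ hc)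
  let e : Y ≅ pullback (c.π.app j) w := hq.isoPullback
  let π' (k : Over j) : pullback (c.π.app j) w ⟶ E.obj k := c'.π.app k
  have hca (k : Over j) : π' k ≫ a k = pullback.fst (c.π.app j) w ≫ c.π.app k.left :=
    pullback.lift_fst _ _ _
  have hcb (k : Over j) : π' k ≫ b k = pullback.snd (c.π.app j) w :=
    pullback.lift_snd _ _ _
  let π : (Functor.const (Over j)).obj Y ⟶ E := (Functor.const (Over j)).map e.hom ≫ c'.π
  refine ⟨E, a, b, π, fun k ↦ .of_hasPullback _ _, ha, hb, fun k ↦ ?_, fun k ↦ ?_,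
    ⟨hc'.ofIsoLimit (Cone.ext e.symm fun k ↦ ?_)⟩⟩
  · exact (Category.assoc e.hom (π' k) (a k)).trans (congr(e.hom ≫ $(hca k)).trans
      (hq.isoPullback_hom_fst_assoc _))
  · exact (Category.assoc e.hom (π' k) (b k)).trans
      (congr(e.hom ≫ $(hcb k)).trans hq.isoPullback_hom_snd)
  · exact (e.inv_hom_id_assoc _).symm

variable [∀ {i j} (φ : i ⟶ j), IsAffineHom (D.map φ)]

include hc in
-- `Y` is the limit of the base changes of `W` to later stages, and a morphism from such a limit to
-- a scheme locally of finite presentation factors through one of them.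
lemma exists_hom_descent {j : I} {Y W W' : Scheme.{u}} {w : W ⟶ D.obj j} {w' : W' ⟶ D.obj j}
    {q : Y ⟶ W} {y : Y ⟶ c.pt} [CompactSpace W] [QuasiSeparatedSpace W]
    [LocallyOfFinitePresentation w'] (hq : IsPullback y q (c.π.app j) w) (q' : Y ⟶ W')
    (hq' : y ≫ c.π.app j = q' ≫ w') :
    ∃ (k : I) (φ : k ⟶ j) (g : pullback (D.map φ) w ⟶ W'),
      g ≫ w' = pullback.fst _ _ ≫ D.map φ ∧
      ∀ l : Y ⟶ pullback (D.map φ) w, l ≫ pullback.fst _ _ = y ≫ c.π.app k →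
        l ≫ pullback.snd _ _ = q → l ≫ g = q' := by
  obtain ⟨E, a, b, π, hp, ha, hb, hπa, hπb, ⟨hlim⟩⟩ := exists_baseChangeDiagram D hc hq
  have haff (k : Over j) : IsAffineHom (b k) :=
    MorphismProperty.of_isPullback (hp k) inferInstance
  have {k l : Over j} (φ : k ⟶ l) : IsAffineHom (E.map φ) := by
    have := haff k
    have : IsAffineHom (E.map φ ≫ b l) := by
      rwa [hb]
    have := haff l
    exact .of_comp _ (b l)
  have (k : Over j) : CompactSpace (E.obj k) :=
    have := haff k
    QuasiCompact.compactSpace_of_compactSpace (b k)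
  have (k : Over j) : QuasiSeparatedSpace (E.obj k) :=
    have := haff k
    quasiSeparatedSpace_of_quasiSeparated (b k)
  let t : E ⟶ (Functor.const (Over j)).obj (D.obj j) :=
    { app k := b k ≫ w
      naturality k l φ := by
        rw [reassoc_of% hb φ]
        exact (Category.comp_id _).symm }
  obtain ⟨k, g, hg, hgt⟩ := Scheme.exists_π_app_comp_eq_of_locallyOfFinitePresentation
    E t w' ⟨Y, π⟩ hlim q' (by
      ext k
      refine (Category.assoc _ _ _).symm.trans ?_
      refine .trans ?_ hq'
      exact congr($(hπb k) ≫ w).trans hq.w.symm)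
  let e := (hp k).isoPullback
  refine ⟨k.left, k.hom, e.inv ≫ g, ?_, fun l hl hl' ↦ ?_⟩
  · rw [Category.assoc, hgt]
    exact ((hp k).isoPullback_inv_snd_assoc w).trans pullback.condition.symm
  · have : l = π.app k ≫ e.hom := by
      refine pullback.hom_ext ?_ ?_
      · rw [Category.assoc]
        exact hl.trans ((hπa k).symm.trans congr(π.app k ≫ $((hp k).isoPullback_hom_fst.symm)))
      · rw [Category.assoc]
        exact hl'.trans ((hπb k).symm.trans congr(π.app k ≫ $((hp k).isoPullback_hom_snd.symm)))
    rw [this, Category.assoc, e.hom_inv_id_assoc]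
    exact hg

include hc in
lemma exists_hom_eq_descent {j : I} {Y W W' : Scheme.{u}} {w : W ⟶ D.obj j} {w' : W' ⟶ D.obj j}
    {q : Y ⟶ W} {y : Y ⟶ c.pt} [CompactSpace W]
    [LocallyOfFiniteType w'] (hq : IsPullback y q (c.π.app j) w) (g g' : W ⟶ W')
    (hg : g ≫ w' = w) (hg' : g' ≫ w' = w) (h : q ≫ g = q ≫ g') :
    ∃ (k : I) (φ : k ⟶ j), ∀ {T : Scheme.{u}} (a : T ⟶ D.obj k) (b : T ⟶ W),
      a ≫ D.map φ = b ≫ w → b ≫ g = b ≫ g' := by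
  obtain ⟨E, a, b, π, hp, ha, hb, hπa, hπb, ⟨hlim⟩⟩ := exists_baseChangeDiagram D hc hq
  have haff (k : Over j) : IsAffineHom (b k) :=
    MorphismProperty.of_isPullback (hp k) inferInstance
  have {k l : Over j} (φ : k ⟶ l) : IsAffineHom (E.map φ) := by
    have := haff k
    have : IsAffineHom (E.map φ ≫ b l) := by
      rwa [hb]
    have := haff l
    exact .of_comp _ (b l)
  have (k : Over j) : CompactSpace (E.obj k) :=
    have := haff k
    QuasiCompact.compactSpace_of_compactSpace (b k)
  let t : E ⟶ (Functor.const (Over j)).obj (D.obj j) :=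
    { app k := b k ≫ w
      naturality k l φ := by
        rw [reassoc_of% hb φ]
        exact (Category.comp_id _).symm }
  let k₀ : Over j := Over.mk (𝟙 j)
  obtain ⟨k, φ, hk⟩ := Scheme.exists_hom_comp_eq_comp_of_locallyOfFiniteType
    E t w' ⟨Y, π⟩ hlim (i := k₀) (b k₀ ≫ g) (b k₀ ≫ g')
    ((congr(b k₀ ≫ $hg.symm)).trans (Category.assoc _ _ _).symm)
    ((congr(b k₀ ≫ $hg'.symm)).trans (Category.assoc _ _ _).symm)
    (((Category.assoc _ _ _).symm.trans congr($(hπb k₀) ≫ g)).trans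
      (h.trans ((Category.assoc _ _ _).symm.trans congr($(hπb k₀) ≫ g')).symm))
  have hk' : b k ≫ g = b k ≫ g' := by
    rw [← hb φ]
    exact (Category.assoc _ _ _).trans (hk.trans (Category.assoc _ _ _).symm)
  refine ⟨k.left, k.hom, fun a' b' hab ↦ ?_⟩
  have hs : (hp k).lift a' b' hab ≫ b k = b' := (hp k).lift_snd _ _ _
  rw [← hs, Category.assoc, Category.assoc, hk']

include hc in
/-- Two quasi-compact quasi-separated schemes of finite presentation over a member of a diagram
become isomorphic at a later stage as soon as their base changes to the limit agree. -/
lemma exists_iso_descent {j : I} {Y W W' : Scheme.{u}} {w : W ⟶ D.obj j} {w' : W' ⟶ D.obj j}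
    {q : Y ⟶ W} {q' : Y ⟶ W'} {y : Y ⟶ c.pt} [CompactSpace W] [QuasiSeparatedSpace W]
    [CompactSpace W'] [QuasiSeparatedSpace W']
    [LocallyOfFinitePresentation w] [LocallyOfFinitePresentation w']
    (hq : IsPullback y q (c.π.app j) w) (hq' : IsPullback y q' (c.π.app j) w') :
    ∃ (k : I) (φ : k ⟶ j) (e : pullback (D.map φ) w ≅ pullback (D.map φ) w'),
      e.hom ≫ pullback.fst _ _ = pullback.fst _ _ ∧
      ∀ (l : Y ⟶ pullback (D.map φ) w), l ≫ pullback.fst _ _ = y ≫ c.π.app k →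
        l ≫ pullback.snd _ _ = q → l ≫ e.hom ≫ pullback.snd _ _ = q' := by
  obtain ⟨k₁, φ₁, g₁, h₁, h₁'⟩ := exists_hom_descent D hc hq q' hq'.w
  obtain ⟨k₂, φ₂, g₂, h₂, h₂'⟩ := exists_hom_descent D hc hq' q hq.w
  obtain ⟨k, α₁, α₂, hα⟩ := IsCofiltered.cospan φ₁ φ₂
  obtain ⟨φ, hφ⟩ : ∃ φ, φ = α₁ ≫ φ₁ := ⟨_, rfl⟩
  have hφ₁ : D.map φ = D.map α₁ ≫ D.map φ₁ := by rw [hφ, D.map_comp]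
  have hφ₂ : D.map φ = D.map α₂ ≫ D.map φ₂ := by rw [hφ, hα, D.map_comp]
  have hcφ : c.π.app k ≫ D.map φ = c.π.app j := c.w φ
  -- `g` and `g'` come from `q'` and `q`, moved to a common stage `k`. They are inverse over the
  -- limit (`hlg`, `hlg'`), though perhaps not yet at `k`.
  let g : pullback (D.map φ) w ⟶ pullback (D.map φ) w' :=
    pullback.lift (pullback.fst _ _) (pullback.lift (pullback.fst _ _ ≫ D.map α₁)
      (pullback.snd _ _) (by rw [Category.assoc, ← hφ₁, pullback.condition]) ≫ g₁)
      (by rw [Category.assoc, h₁, pullback.lift_fst_assoc, Category.assoc, ← hφ₁])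
  let g' : pullback (D.map φ) w' ⟶ pullback (D.map φ) w :=
    pullback.lift (pullback.fst _ _) (pullback.lift (pullback.fst _ _ ≫ D.map α₂)
      (pullback.snd _ _) (by rw [Category.assoc, ← hφ₂, pullback.condition]) ≫ g₂)
      (by rw [Category.assoc, h₂, pullback.lift_fst_assoc, Category.assoc, ← hφ₂])
  have hg : g ≫ pullback.fst _ _ = pullback.fst _ _ := pullback.lift_fst _ _ _
  have hg' : g' ≫ pullback.fst _ _ = pullback.fst _ _ := pullback.lift_fst _ _ _
  let l : Y ⟶ pullback (D.map φ) w := pullback.lift (y ≫ c.π.app k) q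
    (by rw [Category.assoc, hcφ, hq.w])
  let l' : Y ⟶ pullback (D.map φ) w' := pullback.lift (y ≫ c.π.app k) q'
    (by rw [Category.assoc, hcφ, hq'.w])
  have hl₁ : l ≫ pullback.fst _ _ = y ≫ c.π.app k := pullback.lift_fst _ _ _
  have hl₂ : l ≫ pullback.snd _ _ = q := pullback.lift_snd _ _ _
  have hl₁' : l' ≫ pullback.fst _ _ = y ≫ c.π.app k := pullback.lift_fst _ _ _
  have hl₂' : l' ≫ pullback.snd _ _ = q' := pullback.lift_snd _ _ _
  have hlg : l ≫ g = l' := by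
    refine pullback.hom_ext (by rw [Category.assoc, hg, hl₁, hl₁']) ?_
    rw [hl₂', Category.assoc, pullback.lift_snd, ← Category.assoc]
    exact h₁' _ (by rw [Category.assoc, pullback.lift_fst, reassoc_of% hl₁, c.w])
      (by rw [Category.assoc, pullback.lift_snd, hl₂])
  have hlg' : l' ≫ g' = l := by
    refine pullback.hom_ext (by rw [Category.assoc, hg', hl₁, hl₁']) ?_
    rw [hl₂, Category.assoc, pullback.lift_snd, ← Category.assoc]
    exact h₂' _ (by rw [Category.assoc, pullback.lift_fst, reassoc_of% hl₁', c.w])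
      (by rw [Category.assoc, pullback.lift_snd, hl₂'])
  have hpl : IsPullback y l (c.π.app k) (pullback.fst (D.map φ) w) :=
    (IsPullback.of_right (by rw [hl₂, hcφ]; exact hq.flip) hl₁
      (IsPullback.of_hasPullback (D.map φ) w).flip).flip
  have hpl' : IsPullback y l' (c.π.app k) (pullback.fst (D.map φ) w') :=
    (IsPullback.of_right (by rw [hl₂', hcφ]; exact hq'.flip) hl₁'
      (IsPullback.of_hasPullback (D.map φ) w').flip).flip
  have : CompactSpace ↑(pullback (D.map φ) w) :=
    QuasiCompact.compactSpace_of_compactSpace (pullback.snd (D.map φ) w)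
  have : CompactSpace ↑(pullback (D.map φ) w') :=
    QuasiCompact.compactSpace_of_compactSpace (pullback.snd (D.map φ) w')
  -- Both composites agree with the identity over the limit, hence from some stage on; `K` serves
  -- for both.
  obtain ⟨k₃, ψ₁, H₁⟩ := exists_hom_eq_descent D hc hpl (g ≫ g') (𝟙 _)
    (by rw [Category.assoc, hg', hg]) (Category.id_comp _)
    (by rw [reassoc_of% hlg, hlg', Category.comp_id])
  obtain ⟨k₄, ψ₂, H₂⟩ := exists_hom_eq_descent D hc hpl' (g' ≫ g) (𝟙 _)
    (by rw [Category.assoc, hg, hg']) (Category.id_comp _)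
    (by rw [reassoc_of% hlg', hlg, Category.comp_id])
  obtain ⟨K, β₁, β₂, hβ⟩ := IsCofiltered.cospan ψ₁ ψ₂
  obtain ⟨ψ, hψ⟩ : ∃ ψ, ψ = β₁ ≫ ψ₁ := ⟨_, rfl⟩
  have hψ₁ : D.map ψ = D.map β₁ ≫ D.map ψ₁ := by rw [hψ, D.map_comp]
  have hψ₂ : D.map ψ = D.map β₂ ≫ D.map ψ₂ := by rw [hψ, hβ, D.map_comp]
  let N : pullback (D.map (ψ ≫ φ)) w ⟶ pullback (D.map φ) w :=
    pullback.lift (pullback.fst _ _ ≫ D.map ψ) (pullback.snd _ _)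
      (by rw [Category.assoc, ← D.map_comp, pullback.condition])
  let N' : pullback (D.map (ψ ≫ φ)) w' ⟶ pullback (D.map φ) w' :=
    pullback.lift (pullback.fst _ _ ≫ D.map ψ) (pullback.snd _ _)
      (by rw [Category.assoc, ← D.map_comp, pullback.condition])
  have hN₁ : N ≫ pullback.fst _ _ = pullback.fst _ _ ≫ D.map ψ := pullback.lift_fst _ _ _
  have hN₂ : N ≫ pullback.snd _ _ = pullback.snd _ _ := pullback.lift_snd _ _ _
  have hN₁' : N' ≫ pullback.fst _ _ = pullback.fst _ _ ≫ D.map ψ := pullback.lift_fst _ _ _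
  have hN₂' : N' ≫ pullback.snd _ _ = pullback.snd _ _ := pullback.lift_snd _ _ _
  have hNg : N ≫ g ≫ g' = N := by
    simpa using H₁ (pullback.fst _ _ ≫ D.map β₁) N (by rw [Category.assoc, ← hψ₁, hN₁])
  have hNg' : N' ≫ g' ≫ g = N' := by
    simpa using H₂ (pullback.fst _ _ ≫ D.map β₂) N' (by rw [Category.assoc, ← hψ₂, hN₁'])
  let a : pullback (D.map (ψ ≫ φ)) w ⟶ pullback (D.map (ψ ≫ φ)) w' :=
    pullback.lift (pullback.fst _ _) (N ≫ g ≫ pullback.snd _ _) (by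
      rw [Category.assoc, Category.assoc, ← pullback.condition, reassoc_of% hg, reassoc_of% hN₁,
        D.map_comp])
  let b : pullback (D.map (ψ ≫ φ)) w' ⟶ pullback (D.map (ψ ≫ φ)) w :=
    pullback.lift (pullback.fst _ _) (N' ≫ g' ≫ pullback.snd _ _) (by
      rw [Category.assoc, Category.assoc, ← pullback.condition, reassoc_of% hg', reassoc_of% hN₁',
        D.map_comp])
  have ha₁ : a ≫ pullback.fst _ _ = pullback.fst _ _ := pullback.lift_fst _ _ _
  have ha₂ : a ≫ pullback.snd _ _ = N ≫ g ≫ pullback.snd _ _ := pullback.lift_snd _ _ _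
  have hb₁ : b ≫ pullback.fst _ _ = pullback.fst _ _ := pullback.lift_fst _ _ _
  have hb₂ : b ≫ pullback.snd _ _ = N' ≫ g' ≫ pullback.snd _ _ := pullback.lift_snd _ _ _
  have haN : a ≫ N' = N ≫ g := by
    refine pullback.hom_ext ?_ ?_
    · rw [Category.assoc, hN₁', reassoc_of% ha₁, Category.assoc, hg, hN₁]
    · rw [Category.assoc, hN₂', ha₂, Category.assoc]
  have hbN : b ≫ N = N' ≫ g' := by
    refine pullback.hom_ext ?_ ?_
    · rw [Category.assoc, hN₁, reassoc_of% hb₁, Category.assoc, hg', hN₁']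
    · rw [Category.assoc, hN₂, hb₂, Category.assoc]
  refine ⟨K, ψ ≫ φ, ⟨a, b, pullback.hom_ext ?_ ?_, pullback.hom_ext ?_ ?_⟩, ha₁,
    fun m hm₁ hm₂ ↦ ?_⟩
  · rw [Category.assoc, hb₁, ha₁, Category.id_comp]
  · rw [Category.assoc, hb₂, reassoc_of% haN, reassoc_of% hNg, hN₂, Category.id_comp]
  · rw [Category.assoc, ha₁, hb₁, Category.id_comp]
  · rw [Category.assoc, ha₂, reassoc_of% hbN, reassoc_of% hNg', hN₂', Category.id_comp]
  · have hmN : m ≫ N = l := by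
      refine pullback.hom_ext ?_ ?_
      · rw [Category.assoc, hN₁, reassoc_of% hm₁, c.w, hl₁]
      · rw [Category.assoc, hN₂, hm₂, hl₂]
    rw [ha₂, reassoc_of% hmN, reassoc_of% hlg, hl₂']

end HomDescent

/-! ### Locality on the target and gluing along two open subschemes -/

instance : IsZariskiLocalAtTarget (@IsFinite : MorphismProperty Scheme.{u}) := by
  have : HasAffineProperty (@IsFinite : MorphismProperty Scheme.{u}) (affineAnd RingHom.Finite) :=
    (HasAffineProperty.affineAnd_iff _ RingHom.finite_respectsIso
      RingHom.finite_localizationPreserves.away RingHom.finite_ofLocalizationSpan).mpr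
      fun f ↦ by simp [isFinite_iff]
  exact HasAffineProperty.instIsZariskiLocalAtTarget (Q := affineAnd RingHom.Finite)

instance : IsZariskiLocalAtTarget (@Etale : MorphismProperty Scheme.{u}) :=
  HasRingHomProperty.instIsZariskiLocalAtTarget _ (Q := RingHom.Etale)

section TwoOpens

/-- The open cover given by two jointly surjective open immersions. -/
noncomputable def twoCover {X A B : Scheme.{u}} (a : A ⟶ X) (b : B ⟶ X) [IsOpenImmersion a]
    [IsOpenImmersion b] (h : ∀ x : X, (∃ y, a y = x) ∨ ∃ y, b y = x) :
    Scheme.OpenCover.{0} X :=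
  Scheme.Cover.mkOfCovers Bool (fun i ↦ bif i then A else B)
    (fun i ↦ match i with
      | true => a
      | false => b)
    (fun x ↦ (h x).elim (fun ⟨y, hy⟩ ↦ ⟨true, y, hy⟩) (fun ⟨y, hy⟩ ↦ ⟨false, y, hy⟩))
    (fun i ↦ match i with
      | true => ‹_›
      | false => ‹_›)

variable {X A B C : Scheme.{u}} {a : A ⟶ X} {b : B ⟶ X} [IsOpenImmersion a] [IsOpenImmersion b]
  (h : ∀ x : X, (∃ y, a y = x) ∨ ∃ y, b y = x)

include h in
lemma exists_hom_of_two_cover {m : C ⟶ A} {n : C ⟶ B} (hp : IsPullback m n a b)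
    {T : Scheme.{u}} (f : A ⟶ T) (g : B ⟶ T) (hfg : m ≫ f = n ≫ g) :
    ∃ l : X ⟶ T, a ≫ l = f ∧ b ≫ l = g := by
  have e : pullback.fst a b ≫ f = pullback.snd a b ≫ g := by
    rw [← cancel_epi hp.isoPullback.hom, hp.isoPullback_hom_fst_assoc,
      hp.isoPullback_hom_snd_assoc, hfg]
  have e' : pullback.fst b a ≫ g = pullback.snd b a ≫ f := by
    rw [← cancel_epi (pullbackSymmetry a b).hom, pullbackSymmetry_hom_comp_fst_assoc,
      pullbackSymmetry_hom_comp_snd_assoc, e]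
  let k (i : Bool) : (twoCover a b h).X i ⟶ T :=
    match i with
    | true => f
    | false => g
  let l := Scheme.Cover.glueMorphisms (twoCover a b h) k (fun i j ↦
    match i, j with
    | true, true => congr($(fst_eq_snd_of_mono_eq a) ≫ f)
    | true, false => e
    | false, true => e'
    | false, false => congr($(fst_eq_snd_of_mono_eq b) ≫ g))
  exact ⟨l, Scheme.Cover.ι_glueMorphisms (twoCover a b h) k _ true,
    Scheme.Cover.ι_glueMorphisms (twoCover a b h) k _ false⟩

include h in
lemma isPullback_of_two_cover {Y Y₁ Y₂ S T : Scheme.{u}} {q : Y ⟶ X} {y : Y ⟶ T} {w : X ⟶ S}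
    {t : T ⟶ S} {s₁ : Y₁ ⟶ Y} {s₂ : Y₂ ⟶ Y} {q₁ : Y₁ ⟶ A} {q₂ : Y₂ ⟶ B}
    (h₁ : IsPullback s₁ q₁ q a) (h₂ : IsPullback s₂ q₂ q b)
    (h₁' : IsPullback q₁ (s₁ ≫ y) (a ≫ w) t) (h₂' : IsPullback q₂ (s₂ ≫ y) (b ≫ w) t) :
    IsPullback q y w t := by
  refine Scheme.isPullback_of_openCover _ _ _ _ (twoCover a b h) fun i ↦ ?_
  match i with
  | true =>
    change IsPullback (pullback.snd q a) (pullback.fst q a ≫ y) (a ≫ w) t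
    exact h₁'.of_iso h₁.isoPullback (Iso.refl _) (Iso.refl _) (Iso.refl _) (by simp) (by simp)
      (by simp) (by simp)
  | false =>
    change IsPullback (pullback.snd q b) (pullback.fst q b ≫ y) (b ≫ w) t
    exact h₂'.of_iso h₂.isoPullback (Iso.refl _) (Iso.refl _) (Iso.refl _) (by simp) (by simp)
      (by simp) (by simp)

include h in
lemma isFiniteEtale_of_two_cover {W A' B' : Scheme.{u}} {w : W ⟶ X} {a' : A' ⟶ A} {b' : B' ⟶ B}
    {α : A' ⟶ W} {β : B' ⟶ W} (h₁ : IsPullback α a' w a) (h₂ : IsPullback β b' w b)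
    (ha : IsFiniteEtale a') (hb : IsFiniteEtale b') : IsFiniteEtale w := by
  have hsnd (i : Bool) : IsFiniteEtale ((twoCover a b h).pullbackHom w i) := by
    match i with
    | true =>
      have := (IsFiniteEtale.of_isIso h₁.isoPullback.inv).comp ha
      rwa [h₁.isoPullback_inv_snd] at this
    | false =>
      have := (IsFiniteEtale.of_isIso h₂.isoPullback.inv).comp hb
      rwa [h₂.isoPullback_inv_snd] at this
  exact ⟨IsZariskiLocalAtTarget.of_openCover (P := @IsFinite) (twoCover a b h) fun i ↦ (hsnd i).1,
    IsZariskiLocalAtTarget.of_openCover (P := @Etale) (twoCover a b h) fun i ↦ (hsnd i).2⟩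

lemma exists_pushout_of_isOpenImmersion {A B C : Scheme.{u}} (m : C ⟶ A) (n : C ⟶ B)
    [IsOpenImmersion m] [IsOpenImmersion n] :
    ∃ (W : Scheme.{u}) (α : A ⟶ W) (β : B ⟶ W), IsPushout m n α β ∧ IsOpenImmersion α ∧
      IsOpenImmersion β ∧ ∀ x : W, (∃ y, α y = x) ∨ ∃ y, β y = x := by
  have {i j : WalkingSpan} (f : i ⟶ j) : IsOpenImmersion ((span m n).map f) := by
    rcases f with _ | (_ | _)
    · exact ((span m n).map_id i).symm ▸ (inferInstance : IsOpenImmersion (𝟙 _))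
    · exact ‹IsOpenImmersion m›
    · exact ‹IsOpenImmersion n›
  have : ((span m n) ⋙ Scheme.forget).IsLocallyDirected := inferInstance
  have : HasColimit (span m n) := inferInstance
  have : HasPushout m n := this
  refine ⟨pushout m n, pushout.inl m n, pushout.inr m n, .of_hasPushout m n,
    inferInstanceAs (IsOpenImmersion (colimit.ι (span m n) WalkingSpan.left)),
    inferInstanceAs (IsOpenImmersion (colimit.ι (span m n) WalkingSpan.right)), fun x ↦ ?_⟩
  obtain ⟨i, y, hy⟩ := Scheme.IsLocallyDirected.ι_jointly_surjective (span m n) x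
  match i, y, hy with
  | none, y, hy =>
    refine .inl ⟨m y, ?_⟩
    exact hy ▸ congr($(colimit.w (span m n) WalkingSpan.Hom.fst) y)
  | some .left, y, hy => exact .inl ⟨y, hy⟩
  | some .right, y, hy => exact .inr ⟨y, hy⟩

end TwoOpens

/-! ### Schemes finite étale over an open subset -/

section FiniteEtaleOver

/-- A morphism `w : W ⟶ X` is finite étale over the open subset `U` of `X` if it is the composition
of a finite étale morphism `W ⟶ U` and the inclusion of `U`. -/
def IsFiniteEtaleOver {X W : Scheme.{u}} (U : X.Opens) (w : W ⟶ X) : Prop :=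
  ∃ w' : W ⟶ U, w' ≫ U.ι = w ∧ IsFiniteEtale w'

lemma IsFiniteEtaleOver.of_isPullback {X T W Y : Scheme.{u}} {U : X.Opens} {w : W ⟶ X} {q : Y ⟶ W}
    {y : Y ⟶ T} {t : T ⟶ X} (h : IsPullback y q t w) (hw : IsFiniteEtaleOver U w) :
    IsFiniteEtaleOver (t ⁻¹ᵁ U) y := by
  obtain ⟨w', rfl, hw⟩ := hw
  have hr := isPullback_morphismRestrict t U
  let y' := hr.lift (q ≫ w') y (by rw [Category.assoc, h.w])
  have hy' : y' ≫ (t ⁻¹ᵁ U).ι = y := hr.lift_snd _ _ _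
  have hy'' : y' ≫ (t ∣_ U) = q ≫ w' := hr.lift_fst _ _ _
  refine ⟨y', hy', .of_isPullback (q := q) (w := w') (g := t ∣_ U) ?_ hw⟩
  exact (IsPullback.of_right (by rw [hy']; exact h) hy'' hr.flip).flip

lemma IsFiniteEtaleOver.restrict {X W C : Scheme.{u}} {U V : X.Opens} {w : W ⟶ X}
    (hw : IsFiniteEtaleOver U w) (hVU : V ≤ U) (m : C ⟶ W) [IsOpenImmersion m]
    (hm : m.opensRange = w ⁻¹ᵁ V) : IsFiniteEtaleOver V (m ≫ w) := by
  obtain ⟨w', rfl, hw⟩ := hw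
  let c : C ⟶ V := IsOpenImmersion.lift V.ι (m ≫ w' ≫ U.ι) (by
    rintro _ ⟨x, rfl⟩
    have : m x ∈ (w' ≫ U.ι) ⁻¹ᵁ V := hm ▸ ⟨x, rfl⟩
    simpa using this)
  have hc : c ≫ V.ι = m ≫ w' ≫ U.ι := IsOpenImmersion.lift_fac _ _ _
  refine ⟨c, hc, .of_isPullback (q := m) (w := w') (g := X.homOfLE hVU) ?_ hw⟩
  refine (IsOpenImmersion.isPullback c m (X.homOfLE hVU) w' ?_ ?_).flip
  · rw [← cancel_mono U.ι, Category.assoc, ← hc, Category.assoc, Scheme.homOfLE_ι]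
  · rw [hm, Scheme.opensRange_homOfLE]
    rfl

lemma IsFiniteEtaleOver.locallyOfFinitePresentation {X W : Scheme.{u}} {U : X.Opens} {w : W ⟶ X}
    (hw : IsFiniteEtaleOver U w) : LocallyOfFinitePresentation w := by
  obtain ⟨w', rfl, _, _⟩ := hw
  infer_instance

lemma IsFiniteEtaleOver.compactSpace {X W : Scheme.{u}} {U : X.Opens} {w : W ⟶ X}
    (hw : IsFiniteEtaleOver U w) (hU : IsCompact (U : Set X)) : CompactSpace W := by
  obtain ⟨w', rfl, hw⟩ := hw
  have : CompactSpace U := isCompact_iff_compactSpace.mp hU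
  exact hw.compactSpace

lemma IsFiniteEtaleOver.quasiSeparatedSpace {X W : Scheme.{u}} [QuasiSeparatedSpace X]
    {U : X.Opens} {w : W ⟶ X} (hw : IsFiniteEtaleOver U w) : QuasiSeparatedSpace W := by
  obtain ⟨w', rfl, _, _⟩ := hw
  exact quasiSeparatedSpace_of_quasiSeparated (w' ≫ U.ι)

/-- Gluing of schemes that are finite étale over two open subsets. -/
lemma exists_glue_isFiniteEtaleOver {X A B C : Scheme.{u}} {S U : X.Opens} {a : A ⟶ X} {b : B ⟶ X}
    (ha : IsFiniteEtaleOver S a) (hb : IsFiniteEtaleOver U b) (m : C ⟶ A) (n : C ⟶ B)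
    [IsOpenImmersion m] [IsOpenImmersion n] (hmn : m ≫ a = n ≫ b) (hm : m.opensRange = a ⁻¹ᵁ U)
    (hn : n.opensRange = b ⁻¹ᵁ S) :
    ∃ (W : Scheme.{u}) (w : W ⟶ X) (α : A ⟶ W) (β : B ⟶ W) (_ : IsOpenImmersion α)
      (_ : IsOpenImmersion β), IsFiniteEtaleOver (S ⊔ U) w ∧ α ≫ w = a ∧ β ≫ w = b ∧
      m ≫ α = n ≫ β ∧ α.opensRange = w ⁻¹ᵁ S ∧ β.opensRange = w ⁻¹ᵁ U ∧
      ∀ x : W, (∃ y, α y = x) ∨ ∃ y, β y = x := by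
  obtain ⟨W, α, β, hW, _, _, hcov⟩ := exists_pushout_of_isOpenImmersion m n
  obtain ⟨a', rfl, ha⟩ := ha
  obtain ⟨b', rfl, hb⟩ := hb
  let jS := X.homOfLE (le_sup_left : S ≤ S ⊔ U)
  let jU := X.homOfLE (le_sup_right : U ≤ S ⊔ U)
  have hjS : jS ≫ (S ⊔ U).ι = S.ι := Scheme.homOfLE_ι _ _
  have hjU : jU ≫ (S ⊔ U).ι = U.ι := Scheme.homOfLE_ι _ _
  let w' : W ⟶ (S ⊔ U : X.Opens) := hW.desc (a' ≫ jS) (b' ≫ jU) (by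
    rw [← cancel_mono (S ⊔ U).ι]
    simpa [hjS, hjU] using hmn)
  have hα : α ≫ w' = a' ≫ jS := hW.inl_desc _ _ _
  have hβ : β ≫ w' = b' ≫ jU := hW.inr_desc _ _ _
  have hα' : α ≫ w' ≫ (S ⊔ U).ι = a' ≫ S.ι := by rw [reassoc_of% hα, hjS]
  have hβ' : β ≫ w' ≫ (S ⊔ U).ι = b' ≫ U.ι := by rw [reassoc_of% hβ, hjU]
  have hαS : α.opensRange = (w' ≫ (S ⊔ U).ι) ⁻¹ᵁ S := by
    ext x
    constructor
    · rintro ⟨y, rfl⟩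
      have : (α ≫ w' ≫ (S ⊔ U).ι) y ∈ S := hα' ▸ (a' y).2
      exact this
    · intro hx
      obtain ⟨y, hy⟩ | ⟨y, rfl⟩ := hcov x
      · exact ⟨y, hy⟩
      · have hy : (β ≫ w' ≫ (S ⊔ U).ι) y ∈ S := hx
        rw [hβ'] at hy
        have : y ∈ n.opensRange := hn ▸ hy
        obtain ⟨z, rfl⟩ := this
        exact ⟨m z, congr($hW.w z)⟩
  have hβU : β.opensRange = (w' ≫ (S ⊔ U).ι) ⁻¹ᵁ U := by
    ext x
    constructor
    · rintro ⟨y, rfl⟩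
      have : (β ≫ w' ≫ (S ⊔ U).ι) y ∈ U := hβ' ▸ (b' y).2
      exact this
    · intro hx
      obtain ⟨y, rfl⟩ | ⟨y, hy⟩ := hcov x
      · have hy : (α ≫ w' ≫ (S ⊔ U).ι) y ∈ U := hx
        rw [hα'] at hy
        have : y ∈ m.opensRange := hm ▸ hy
        obtain ⟨z, rfl⟩ := this
        exact ⟨n z, congr($hW.w.symm z)⟩
      · exact ⟨y, hy⟩
  refine ⟨W, w' ≫ (S ⊔ U).ι, α, β, ‹_›, ‹_›, ⟨w', rfl, ?_⟩, hα', hβ', hW.w, hαS, hβU, hcov⟩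
  refine isFiniteEtale_of_two_cover (a := jS) (b := jU) ?_
    (IsOpenImmersion.isPullback a' α jS w' hα ?_).flip
    (IsOpenImmersion.isPullback b' β jU w' hβ ?_).flip ha hb
  · rintro ⟨x, hx | hx⟩
    · exact .inl ⟨⟨x, hx⟩, Subtype.ext congr($hjS ⟨x, hx⟩)⟩
    · exact .inr ⟨⟨x, hx⟩, Subtype.ext congr($hjU ⟨x, hx⟩)⟩
  · rw [hαS, Scheme.opensRange_homOfLE]
    rfl
  · rw [hβU, Scheme.opensRange_homOfLE]
    rfl

end FiniteEtaleOver

section TwoOpens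

lemma hom_ext_of_two_cover {X A B T : Scheme.{u}} {a : A ⟶ X} {b : B ⟶ X} [IsOpenImmersion a]
    [IsOpenImmersion b] (h : ∀ x : X, (∃ y, a y = x) ∨ ∃ y, b y = x) {f g : X ⟶ T}
    (ha : a ≫ f = a ≫ g) (hb : b ≫ f = b ≫ g) : f = g := by
  refine Scheme.Cover.hom_ext (twoCover a b h) _ _ fun i ↦ ?_
  match i with
  | true => exact ha
  | false => exact hb

lemma exists_isPullback_restrict {Z Z' T W X : Scheme.{u}} {z : Z ⟶ T} {q : Z ⟶ W} {w : W ⟶ X}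
    {t : T ⟶ X} (h : IsPullback z q t w) (U : X.Opens) (m : Z' ⟶ Z) [IsOpenImmersion m]
    (hm : m.opensRange = (z ≫ t) ⁻¹ᵁ U) :
    ∃ q' : Z' ⟶ ((w ⁻¹ᵁ U : W.Opens) : Scheme.{u}), q' ≫ (w ⁻¹ᵁ U).ι = m ≫ q ∧
      IsPullback (m ≫ z) q' t ((w ⁻¹ᵁ U).ι ≫ w) := by
  have hm' : m.opensRange = q ⁻¹ᵁ (w ⁻¹ᵁ U) := by rw [hm, h.w, Scheme.Hom.comp_preimage]
  let q' : Z' ⟶ ((w ⁻¹ᵁ U : W.Opens) : Scheme.{u}) := IsOpenImmersion.lift (w ⁻¹ᵁ U).ι (m ≫ q) (by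
    rintro _ ⟨x, rfl⟩
    have : m x ∈ q ⁻¹ᵁ (w ⁻¹ᵁ U) := hm' ▸ ⟨x, rfl⟩
    simpa using this)
  have hq' : q' ≫ (w ⁻¹ᵁ U).ι = m ≫ q := IsOpenImmersion.lift_fac _ _ _
  refine ⟨q', hq', IsPullback.paste_horiz ?_ h⟩
  exact (IsOpenImmersion.isPullback q' m _ q hq'.symm (by
    rw [Scheme.Opens.opensRange_ι, hm'])).flip

lemma exists_pullback_opens {X' X W : Scheme.{u}} (g : X' ⟶ X) (w : W ⟶ X) (U : X.Opens) :
    ∃ (m : pullback g ((w ⁻¹ᵁ U).ι ≫ w) ⟶ pullback g w) (_ : IsOpenImmersion m),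
      m.opensRange = pullback.fst g w ⁻¹ᵁ (g ⁻¹ᵁ U) ∧ m ≫ pullback.fst _ _ = pullback.fst _ _ ∧
        m ≫ pullback.snd _ _ = pullback.snd _ _ ≫ (w ⁻¹ᵁ U).ι := by
  let m : pullback g ((w ⁻¹ᵁ U).ι ≫ w) ⟶ pullback g w :=
    pullback.lift (pullback.fst _ _) (pullback.snd _ _ ≫ (w ⁻¹ᵁ U).ι)
      (by rw [Category.assoc, pullback.condition])
  have h₁ : m ≫ pullback.fst _ _ = pullback.fst _ _ := pullback.lift_fst _ _ _
  have h₂ : m ≫ pullback.snd _ _ = pullback.snd _ _ ≫ (w ⁻¹ᵁ U).ι := pullback.lift_snd _ _ _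
  have hp : IsPullback m (pullback.snd _ _) (pullback.snd g w) (w ⁻¹ᵁ U).ι := by
    refine IsPullback.of_right (h₁₂ := pullback.fst g w) (v₁₃ := g) (h₂₂ := w) ?_ h₂
      (IsPullback.of_hasPullback g w)
    rw [h₁]
    exact .of_hasPullback _ _
  refine ⟨m, MorphismProperty.of_isPullback (P := @IsOpenImmersion) hp.flip inferInstance, ?_, h₁,
    h₂⟩
  rw [← Scheme.Hom.comp_preimage, pullback.condition, Scheme.Hom.comp_preimage]
  ext x
  constructor
  · rintro ⟨y, rfl⟩
    have : (m ≫ pullback.snd _ _) y ∈ w ⁻¹ᵁ U := by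
      rw [h₂]
      exact (pullback.snd g ((w ⁻¹ᵁ U).ι ≫ w) y).2
    exact this
  · intro hx
    obtain ⟨y, hy, -⟩ := Scheme.exists_preimage_of_isPullback hp x ⟨_, hx⟩ rfl
    exact ⟨y, hy⟩

lemma IsFiniteEtaleOver.preimage_eq_top {X W : Scheme.{u}} {U : X.Opens} {w : W ⟶ X}
    (hw : IsFiniteEtaleOver U w) : w ⁻¹ᵁ U = ⊤ := by
  obtain ⟨w', rfl, -⟩ := hw
  ext x
  simp

end TwoOpens

/-! ### Descent of finite étale morphisms to a finite stage -/

section Descent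

variable {I : Type u} [SmallCategory I] [IsCofiltered I] (D : I ⥤ Scheme.{u})
  {c : Cone D} (hc : IsLimit c) {Y : Scheme.{u}} (f : Y ⟶ c.pt)

/-- The restriction of `f` to the inverse image of an open subset `U` of `D.obj i` descends to the
inverse image of `U` in `D.obj j`. -/
def DescendsAt {i j : I} (h : j ⟶ i) (U : (D.obj i).Opens) : Prop :=
  ∃ (W : Scheme.{u}) (w : W ⟶ D.obj j) (q : (((f ≫ c.π.app i) ⁻¹ᵁ U : Y.Opens) : Scheme.{u}) ⟶ W),
    IsFiniteEtaleOver (D.map h ⁻¹ᵁ U) w ∧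
      IsPullback (((f ≫ c.π.app i) ⁻¹ᵁ U).ι ≫ f) q (c.π.app j) w

lemma isPullback_lift_of_comp {T W X' X Z : Scheme.{u}} {q : Z ⟶ W} {z : Z ⟶ T} {w : W ⟶ X}
    {t : T ⟶ X'} {g : X' ⟶ X} (h : IsPullback z q (t ≫ g) w) :
    ∃ l : Z ⟶ pullback g w, l ≫ pullback.fst _ _ = z ≫ t ∧ l ≫ pullback.snd _ _ = q ∧
      IsPullback z l t (pullback.fst g w) := by
  let l : Z ⟶ pullback g w := pullback.lift (z ≫ t) q (by rw [Category.assoc, h.w])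
  have h₁ : l ≫ pullback.fst _ _ = z ≫ t := pullback.lift_fst _ _ _
  have h₂ : l ≫ pullback.snd _ _ = q := pullback.lift_snd _ _ _
  refine ⟨l, h₁, h₂, (IsPullback.of_right ?_ h₁ (IsPullback.of_hasPullback g w).flip).flip⟩
  rw [h₂]
  exact h.flip

variable {D f} in
omit [IsCofiltered I] in
lemma DescendsAt.refine {i j k : I} {h : j ⟶ i} {U : (D.obj i).Opens} (H : DescendsAt D f h U)
    (φ : k ⟶ j) : DescendsAt D f (φ ≫ h) U := by
  obtain ⟨W, w, q, hw, hq⟩ := H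
  obtain ⟨l, -, -, hl⟩ := isPullback_lift_of_comp (t := c.π.app k) (g := D.map φ)
    (by rw [c.w]; exact hq)
  refine ⟨_, pullback.fst (D.map φ) w, l, ?_, hl⟩
  have := hw.of_isPullback (IsPullback.of_hasPullback (D.map φ) w)
  rwa [← Scheme.Hom.comp_preimage, ← D.map_comp] at this

variable [∀ {i j} (φ : i ⟶ j), IsAffineHom (D.map φ)] [∀ i, CompactSpace (D.obj i)]
  [∀ i, QuasiSeparatedSpace (D.obj i)]

omit [∀ i, CompactSpace (D.obj i)] in
include hc in
-- The inverse images of `U` at the stages over `i` form a diagram whose limit is the inverse image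
-- of `U` in `c.pt`. This limit is affine because the projection to `D.obj i` is, so the affine case
-- applies.
lemma exists_descendsAt_of_isAffineOpen (hf : IsFiniteEtale f) {i : I} (U : (D.obj i).Opens)
    (hU : IsAffineOpen U) : ∃ (j : I) (h : j ⟶ i), DescendsAt D f h U := by
  have (j : Over i) : CompactSpace ↥((opensDiagram D i U).obj j) :=
    isCompact_iff_compactSpace.mp (QuasiCompact.isCompact_preimage (f := (D.map j.hom)) _ U.2
      hU.isCompact)
  have (j : Over i) : QuasiSeparatedSpace ↥((opensDiagram D i U).obj j) :=
    (isQuasiSeparated_iff_quasiSeparatedSpace _ (D.map _ ⁻¹ᵁ _).2).mp (.of_quasiSeparatedSpace _)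
  have := isAffineHom_π_app D c hc i
  have : IsAffine (opensCone D c i U).pt := hU.preimage (c.π.app i)
  let V : c.pt.Opens := c.π.app i ⁻¹ᵁ U
  have hr := isPullback_morphismRestrict f V
  obtain ⟨j, W, w, q, hw, hq⟩ := exists_finiteEtale_descent_of_isAffine (opensDiagram D i U)
    (isLimitOpensCone D c hc i U) (f ∣_ V) (hf.of_isPullback hr.flip)
  let h : j.left ⟶ i := j.hom
  let g : (V : Scheme.{u}) ⟶ (D.map h ⁻¹ᵁ U : (D.obj j.left).Opens) := (opensCone D c i U).π.app j
  have hg : g ≫ (D.map h ⁻¹ᵁ U).ι = V.ι ≫ c.π.app j.left := Scheme.Hom.resLE_comp_ι _ _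
  let w' : W ⟶ (D.map h ⁻¹ᵁ U : (D.obj j.left).Opens) := w
  have hq' : IsPullback (f ∣_ V) q g w' := hq.flip
  refine ⟨j.left, h, W, w' ≫ (D.map h ⁻¹ᵁ U).ι, q, ⟨w', rfl, hw⟩, ?_⟩
  have hV : IsPullback V.ι g (c.π.app j.left) (D.map h ⁻¹ᵁ U).ι :=
    (IsOpenImmersion.isPullback _ _ _ _ hg.symm (by
      simp only [Scheme.Opens.opensRange_ι]
      rw [← Scheme.Hom.comp_preimage, c.w])).flip
  exact morphismRestrict_ι f V ▸ hq'.paste_horiz hV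

omit [∀ i, CompactSpace (D.obj i)] in
include hc in
-- The descents over `S` and over `U` need not agree on the overlap, but there they have the same
-- base change to the limit, so they become isomorphic at a later stage and can be glued.
-- Quasi-separatedness keeps the overlap quasi-compact, as `exists_iso_descent` needs.
lemma exists_descendsAt_sup {i : I} {S U : (D.obj i).Opens}
    (hS : IsCompact (S : Set (D.obj i))) (hU : IsCompact (U : Set (D.obj i)))
    (HS : ∃ (j : I) (h : j ⟶ i), DescendsAt D f h S)
    (HU : ∃ (j : I) (h : j ⟶ i), DescendsAt D f h U) :
    ∃ (j : I) (h : j ⟶ i), DescendsAt D f h (S ⊔ U) := by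
  obtain ⟨j₁, h₁, H₁⟩ := HS
  obtain ⟨j₂, h₂, H₂⟩ := HU
  obtain ⟨k, α₁, α₂, hα⟩ := IsCofiltered.cospan h₁ h₂
  have H₁' := H₁.refine α₁
  have H₂' := H₂.refine α₂
  rw [← hα] at H₂'
  obtain ⟨h, hh⟩ : ∃ h, h = α₁ ≫ h₁ := ⟨_, rfl⟩
  rw [← hh] at H₁' H₂'
  obtain ⟨A, a, qA, ha, hA⟩ := H₁'
  obtain ⟨B, b, qB, hb, hB⟩ := H₂'
  let Sk := D.map h ⁻¹ᵁ S
  let Uk := D.map h ⁻¹ᵁ U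
  let YS : Y.Opens := (f ≫ c.π.app i) ⁻¹ᵁ S
  let YU : Y.Opens := (f ≫ c.π.app i) ⁻¹ᵁ U
  let iS := Y.homOfLE (inf_le_left : YS ⊓ YU ≤ YS)
  let iU := Y.homOfLE (inf_le_right : YS ⊓ YU ≤ YU)
  have hiS : iS ≫ YS.ι = (YS ⊓ YU).ι := Scheme.homOfLE_ι _ _
  have hiU : iU ≫ YU.ι = (YS ⊓ YU).ι := Scheme.homOfLE_ι _ _
  have hck : c.π.app i = c.π.app k ≫ D.map h := (c.w h).symm
  obtain ⟨qCA, hqCA, hCA⟩ := exists_isPullback_restrict hA Uk iS (by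
    have : ((YS.ι ≫ f) ≫ c.π.app k) ⁻¹ᵁ Uk = YS.ι ⁻¹ᵁ YU := by
      rw [← Scheme.Hom.comp_preimage, ← Scheme.Hom.comp_preimage, hck]
      simp only [Category.assoc]
    rw [Scheme.opensRange_homOfLE, this]
    ext x
    exact ⟨fun h ↦ h.2, fun h ↦ ⟨x.2, h⟩⟩)
  obtain ⟨qCB, hqCB, hCB⟩ := exists_isPullback_restrict hB Sk iU (by
    have : ((YU.ι ≫ f) ≫ c.π.app k) ⁻¹ᵁ Sk = YU.ι ⁻¹ᵁ YS := by
      rw [← Scheme.Hom.comp_preimage, ← Scheme.Hom.comp_preimage, hck]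
      simp only [Category.assoc]
    rw [Scheme.opensRange_homOfLE, this]
    ext x
    exact ⟨fun h ↦ h.1, fun h ↦ ⟨h, x.2⟩⟩)
  rw [reassoc_of% hiS] at hCA
  rw [reassoc_of% hiU] at hCB
  have hFA : IsFiniteEtaleOver (Sk ⊓ Uk) ((a ⁻¹ᵁ Uk).ι ≫ a) :=
    ha.restrict inf_le_left _ (by
      have := ha.preimage_eq_top
      rw [Scheme.Opens.opensRange_ι, Scheme.Hom.preimage_inf, this, top_inf_eq])
  have hFB : IsFiniteEtaleOver (Sk ⊓ Uk) ((b ⁻¹ᵁ Sk).ι ≫ b) :=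
    hb.restrict inf_le_right _ (by
      have := hb.preimage_eq_top
      rw [Scheme.Opens.opensRange_ι, Scheme.Hom.preimage_inf, this, inf_top_eq])
  have hcpt : IsCompact ((Sk ⊓ Uk : (D.obj k).Opens) : Set (D.obj k)) :=
    QuasiCompact.isCompact_preimage (f := D.map h) _ (S ⊓ U).2
      (QuasiSeparatedSpace.inter_isCompact _ _ S.2 hS U.2 hU)
  have := hFA.compactSpace hcpt
  have := hFB.compactSpace hcpt
  have := hFA.quasiSeparatedSpace
  have := hFB.quasiSeparatedSpace
  have := hFA.locallyOfFinitePresentation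
  have := hFB.locallyOfFinitePresentation
  obtain ⟨K, φ, e, he₁, he₂⟩ := exists_iso_descent D hc hCA hCB
  obtain ⟨m, _, hm, hm₁, hm₂⟩ := exists_pullback_opens (D.map φ) a Uk
  obtain ⟨n, _, hn, hn₁, hn₂⟩ := exists_pullback_opens (D.map φ) b Sk
  obtain ⟨W, w, α, β, _, _, hw, hαw, hβw, hmn, hα, hβ, hcov⟩ := exists_glue_isFiniteEtaleOver
    (ha.of_isPullback (IsPullback.of_hasPullback (D.map φ) a))
    (hb.of_isPullback (IsPullback.of_hasPullback (D.map φ) b)) m (e.hom ≫ n)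
    (by rw [Category.assoc, hn₁, he₁, hm₁]) hm
    (by rw [Scheme.Hom.opensRange_comp_of_isIso, hn])
  have hcK : c.π.app k = c.π.app K ≫ D.map φ := (c.w φ).symm
  obtain ⟨lA, hlA₁, hlA₂, hlA⟩ := isPullback_lift_of_comp (by rw [← hcK]; exact hA)
  obtain ⟨lB, hlB₁, hlB₂, hlB⟩ := isPullback_lift_of_comp (by rw [← hcK]; exact hB)
  obtain ⟨l₀, hl₀₁, hl₀₂, -⟩ := isPullback_lift_of_comp (by rw [← hcK]; exact hCA)
  have hl₀e := he₂ l₀ (by rw [hl₀₁, Category.assoc]) hl₀₂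
  -- The projections from the two parts of `Y` to the glued pieces agree on the overlap because the
  -- descended isomorphism `e` is compatible with the identity over the limit; they therefore glue
  -- to `q`.
  have hlm : l₀ ≫ m = iS ≫ lA := by
    refine pullback.hom_ext ?_ ?_
    · rw [Category.assoc, hm₁, hl₀₁, Category.assoc iS, hlA₁, Category.assoc, Category.assoc,
        reassoc_of% hiS]
    · rw [Category.assoc, hm₂, reassoc_of% hl₀₂, hqCA, Category.assoc, hlA₂]
  have hln : l₀ ≫ e.hom ≫ n = iU ≫ lB := by
    refine pullback.hom_ext ?_ ?_
    · simp only [Category.assoc]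
      rw [hn₁, he₁, hl₀₁, hlB₁, Category.assoc, Category.assoc, reassoc_of% hiU]
    · simp only [Category.assoc]
      rw [hn₂, reassoc_of% hl₀e, hqCB, hlB₂]
  let jS := Y.homOfLE (le_sup_left : YS ≤ YS ⊔ YU)
  let jU := Y.homOfLE (le_sup_right : YU ≤ YS ⊔ YU)
  have hjS : jS ≫ (YS ⊔ YU).ι = YS.ι := Scheme.homOfLE_ι _ _
  have hjU : jU ≫ (YS ⊔ YU).ι = YU.ι := Scheme.homOfLE_ι _ _
  have hcovY : ∀ x : (YS ⊔ YU : Y.Opens), (∃ y, jS y = x) ∨ ∃ y, jU y = x := by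
    rintro ⟨x, hx | hx⟩
    · exact .inl ⟨⟨x, hx⟩, Subtype.ext congr($hjS ⟨x, hx⟩)⟩
    · exact .inr ⟨⟨x, hx⟩, Subtype.ext congr($hjU ⟨x, hx⟩)⟩
  obtain ⟨q, hqS, hqU⟩ := exists_hom_of_two_cover hcovY
    (isPullback_opens_inf_le le_sup_left le_sup_right) (lA ≫ α) (lB ≫ β) (by
      have := congr(l₀ ≫ $hmn)
      rw [reassoc_of% hlm] at this
      rw [this]
      exact (Category.assoc _ _ _).symm.trans ((Category.assoc _ _ _).symm.trans
        ((congr($(Category.assoc l₀ e.hom n) ≫ β)).trans (congr($hln ≫ β).trans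
        (Category.assoc _ _ _)))))
  have hqw : q ≫ w = (YS ⊔ YU).ι ≫ f ≫ c.π.app K := by
    refine hom_ext_of_two_cover hcovY ?_ ?_
    · rw [reassoc_of% hqS, hαw, hlA₁, reassoc_of% hjS, Category.assoc]
    · rw [reassoc_of% hqU, hβw, hlB₁, reassoc_of% hjU, Category.assoc]
  have hcKi (V : (D.obj i).Opens) :
      ((YS ⊔ YU).ι ≫ f ≫ c.π.app K) ⁻¹ᵁ (D.map φ ⁻¹ᵁ (D.map h ⁻¹ᵁ V)) =
      (YS ⊔ YU).ι ⁻¹ᵁ ((f ≫ c.π.app i) ⁻¹ᵁ V) := by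
    rw [← Scheme.Hom.comp_preimage, ← Scheme.Hom.comp_preimage, ← Scheme.Hom.comp_preimage, hck,
      hcK]
    simp only [Category.assoc]
  refine ⟨K, φ ≫ h, W, w, q, ?_, ?_⟩
  · rw [D.map_comp, Scheme.Hom.comp_preimage]
    exact hw
  · refine (isPullback_of_two_cover hcov (s₁ := jS) (s₂ := jU) (q₁ := lA) (q₂ := lB)
      (IsOpenImmersion.isPullback _ _ _ _ hqS ?_).flip
      (IsOpenImmersion.isPullback _ _ _ _ hqU ?_).flip ?_ ?_).flip
    · rw [hα, ← Scheme.Hom.comp_preimage, hqw, Scheme.opensRange_homOfLE, hcKi]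
    · rw [hβ, ← Scheme.Hom.comp_preimage, hqw, Scheme.opensRange_homOfLE, hcKi]
    · rw [hαw]
      exact (reassoc_of% hjS) f ▸ hlA.flip
    · rw [hβw]
      exact (reassoc_of% hjU) f ▸ hlB.flip

include hc in
-- At a fixed stage `i`, induction on compact open subsets adds one affine open at a time until all
-- of `D.obj i` is reached.
theorem exists_finiteEtale_descent (hf : IsFiniteEtale f) :
    ∃ (i : I) (W : Scheme.{u}) (w : W ⟶ D.obj i) (q : Y ⟶ W), IsFiniteEtale w ∧
      IsPullback q f w (c.π.app i) := by
  obtain ⟨i⟩ := IsCofiltered.nonempty (C := I)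
  have key : ∃ (j : I) (h : j ⟶ i), DescendsAt D f h ⊤ := by
    refine compact_open_induction_on (X := D.obj i) ⊤ isCompact_univ ?_ fun S hS U HS ↦ ?_
    · exact exists_descendsAt_of_isAffineOpen D hc f hf ⊥ (isAffineOpen_bot _)
    · exact exists_descendsAt_sup D hc f hS U.2.isCompact HS
        (exists_descendsAt_of_isAffineOpen D hc f hf U.1 U.2)
  obtain ⟨j, h, W, w, q, ⟨w', rfl, hw⟩, hq⟩ := key
  have hY : IsIso ((f ≫ c.π.app i) ⁻¹ᵁ (⊤ : (D.obj i).Opens)).ι :=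
    inferInstanceAs (IsIso Y.topIso.hom)
  have hW : IsIso (D.map h ⁻¹ᵁ (⊤ : (D.obj i).Opens)).ι :=
    inferInstanceAs (IsIso (D.obj j).topIso.hom)
  refine ⟨j, W, _, inv ((f ≫ c.π.app i) ⁻¹ᵁ (⊤ : (D.obj i).Opens)).ι ≫ q,
    hw.comp (IsFiniteEtale.of_isIso (D.map h ⁻¹ᵁ (⊤ : (D.obj i).Opens)).ι), ?_⟩
  exact hq.flip.of_iso (asIso ((f ≫ c.π.app i) ⁻¹ᵁ (⊤ : (D.obj i).Opens)).ι) (Iso.refl _)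
    (Iso.refl _) (Iso.refl _)
    ((Category.comp_id _).trans (IsIso.hom_inv_id_assoc _ _).symm) (by simp) (by simp) (by simp)

end Descent

/-- A cofiltered limit of connected quasi-compact quasi-separated schemes with affine transition
maps is connected. -/
theorem connectedSpace_of_isLimit {I : Type u} [SmallCategory I] [IsCofiltered I]
    (D : I ⥤ Scheme.{u}) {c : Cone D} (hc : IsLimit c)
    [∀ {i j} (φ : i ⟶ j), IsAffineHom (D.map φ)] [∀ i, ConnectedSpace (D.obj i)]
    [∀ i, CompactSpace (D.obj i)] [∀ i, QuasiSeparatedSpace (D.obj i)] :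
    ConnectedSpace c.pt := by
  have := Scheme.compactSpace_of_isLimit D c hc
  have hne : Nonempty c.pt := Scheme.nonempty_of_isLimit D c hc
  refine connectedSpace_iff_clopen.mpr ⟨hne, fun s hs ↦ ?_⟩
  let U : c.pt.Opens := ⟨s, hs.2⟩
  let V : c.pt.Opens := ⟨sᶜ, hs.compl.2⟩
  -- The clopen set and its complement are compact open, so both come from a finite stage.
  obtain ⟨i₁, U₁, hU₁, hU⟩ := exists_preimage_eq D c hc U hs.1.isCompact
  obtain ⟨i₂, V₁, hV₁, hV⟩ := exists_preimage_eq D c hc V hs.compl.1.isCompact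
  obtain ⟨i, φ, ψ, -⟩ := IsCofilteredOrEmpty.cone_objs i₁ i₂
  have hU' : c.π.app i ⁻¹ᵁ (D.map φ ⁻¹ᵁ U₁) = U := by
    rw [← Scheme.Hom.comp_preimage, c.w, hU]
  have hV' : c.π.app i ⁻¹ᵁ (D.map ψ ⁻¹ᵁ V₁) = V := by
    rw [← Scheme.Hom.comp_preimage, c.w, hV]
  have hUc : IsCompact ((D.map φ ⁻¹ᵁ U₁ : (D.obj i).Opens) : Set (D.obj i)) :=
    QuasiCompact.isCompact_preimage (f := D.map φ) _ U₁.2 hU₁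
  have hVc : IsCompact ((D.map ψ ⁻¹ᵁ V₁ : (D.obj i).Opens) : Set (D.obj i)) :=
    QuasiCompact.isCompact_preimage (f := D.map ψ) _ V₁.2 hV₁
  generalize D.map φ ⁻¹ᵁ U₁ = U₂ at hU' hUc
  generalize D.map ψ ⁻¹ᵁ V₁ = V₂ at hV' hVc
  -- Covering and disjointness are equalities of compact opens over the limit, so each holds from
  -- some stage on. At the common stage `l` the decomposition is clopen, hence trivial.
  obtain ⟨j, a, ha⟩ := exists_map_preimage_eq_map_preimage D c hc (U := U₂ ⊔ V₂) (V := ⊤)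
    (hUc.union hVc) isCompact_univ (by
      refine TopologicalSpace.Opens.ext ?_
      change ((c.π.app i ⁻¹ᵁ U₂ : c.pt.Opens) : Set c.pt) ∪
        ((c.π.app i ⁻¹ᵁ V₂ : c.pt.Opens) : Set c.pt) = Set.univ
      rw [hU', hV']
      exact Set.union_compl_self s)
  obtain ⟨k, b, hb⟩ := exists_map_preimage_eq_map_preimage D c hc (U := U₂ ⊓ V₂) (V := ⊥)
    (hUc.inter_of_isOpen hVc U₂.2 V₂.2) isCompact_empty (by
      refine TopologicalSpace.Opens.ext ?_
      change ((c.π.app i ⁻¹ᵁ U₂ : c.pt.Opens) : Set c.pt) ∩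
        ((c.π.app i ⁻¹ᵁ V₂ : c.pt.Opens) : Set c.pt) = ∅
      rw [hU', hV']
      exact Set.inter_compl_self s)
  obtain ⟨l, α, β, hαβ⟩ := IsCofiltered.cospan a b
  have hu (y : D.obj l) : D.map (α ≫ a) y ∈ U₂ ∨ D.map (α ≫ a) y ∈ V₂ := by
    have : D.map α y ∈ D.map a ⁻¹ᵁ (U₂ ⊔ V₂) := by rw [ha]; trivial
    rw [D.map_comp]
    exact this
  have hn (y : D.obj l) (h₁ : D.map (α ≫ a) y ∈ U₂) (h₂ : D.map (α ≫ a) y ∈ V₂) : False := by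
    rw [hαβ, D.map_comp] at h₁ h₂
    have : D.map β y ∈ D.map b ⁻¹ᵁ (U₂ ⊓ V₂) := ⟨h₁, h₂⟩
    rw [hb] at this
    exact this
  have hcl : IsClopen ((D.map (α ≫ a) ⁻¹ᵁ U₂ : (D.obj l).Opens) : Set (D.obj l)) := by
    refine ⟨isOpen_compl_iff.mp ?_, (D.map (α ≫ a) ⁻¹ᵁ U₂).2⟩
    convert (D.map (α ≫ a) ⁻¹ᵁ V₂).2 using 1
    ext y
    exact ⟨fun h ↦ (hu y).resolve_left h, fun h h' ↦ hn y h' h⟩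
  have hs' : s = c.π.app l ⁻¹' ((D.map (α ≫ a) ⁻¹ᵁ U₂ : (D.obj l).Opens) : Set (D.obj l)) := by
    change ((U : c.pt.Opens) : Set c.pt) =
      ((c.π.app l ⁻¹ᵁ (D.map (α ≫ a) ⁻¹ᵁ U₂) : c.pt.Opens) : Set c.pt)
    rw [← Scheme.Hom.comp_preimage, c.w, hU']
  rcases isClopen_iff.mp hcl with h | h
  · exact .inl (by rw [hs', h, Set.preimage_empty])
  · exact .inr (by rw [hs', h, Set.preimage_univ])

/-! ### Pointed schemes: thinness and cofilteredness -/

section Pointed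

variable {X P : Scheme.{u}} {x : P ⟶ X}

/-- The pointed scheme given by a morphism `f : Y ⟶ X` and a lift `y` of `x`. -/
abbrev pointedMk {Y : Scheme.{u}} (f : Y ⟶ X) (y : P ⟶ Y) (h : y ≫ f = x) : PointedScheme x :=
  Under.mk (Over.homMk y h : Over.mk x ⟶ Over.mk f)

/-- The given point of a pointed scheme. -/
def point (A : PointedScheme x) : P ⟶ (toScheme x).obj A :=
  A.hom.left

lemma point_structureMap (A : PointedScheme x) : point A ≫ structureMap A = x :=
  Over.w A.hom

/-- A morphism of schemes over `X` preserving the points is a morphism of pointed schemes. -/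
abbrev pointedHomMk {A B : PointedScheme x} (g : (toScheme x).obj A ⟶ (toScheme x).obj B)
    (h : g ≫ structureMap B = structureMap A) (h' : point A ≫ g = point B) : A ⟶ B :=
  Under.homMk (Over.homMk g h) (Over.OverMorphism.ext h')

lemma structureMap_comp {A B : PointedScheme x} (g : A ⟶ B) :
    (toScheme x).map g ≫ structureMap B = structureMap A :=
  Over.w g.right

lemma point_comp {A B : PointedScheme x} (g : A ⟶ B) :
    point A ≫ (toScheme x).map g = point B :=
  congr(($(Under.w g)).left)

lemma over_hom_ext_of_connectedSpace [Nonempty P] {A : PointedScheme x}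
    (hA : ConnectedSpace ((toScheme x).obj A)) {B : Over X} (hB : IsFiniteEtale B.hom)
    (g h : A.right ⟶ B) (hgh : A.hom ≫ g = A.hom ≫ h) : g = h := by
  obtain ⟨_, _⟩ := hB
  have : ConnectedSpace A.right.left := hA
  exact Over.OverMorphism.ext (hom_ext_of_connectedSpace (P := P) B.hom g.left h.left
    ((Over.w g).trans (Over.w h).symm) (point A) congr(($hgh).left))

lemma pointed_hom_ext_of_connectedSpace [Nonempty P] {A B : PointedScheme x}
    (hA : ConnectedSpace ((toScheme x).obj A)) (hB : IsProfiniteEtale (structureMap B))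
    (g h : A ⟶ B) : g = h := by
  obtain ⟨J, _, _, D, π, hD, ⟨hlim⟩⟩ := hB
  refine Under.UnderMorphism.ext (hlim.hom_ext fun j ↦ ?_)
  exact over_hom_ext_of_connectedSpace hA (hD j) _ _
    ((Category.assoc _ _ _).symm.trans (congr($((Under.w g).trans (Under.w h).symm) ≫ π.app j).trans
      (Category.assoc _ _ _)))

/-- The source is the connected clopen piece through the base point. This supplies the maps from the
limit to arbitrary pointed finite étale schemes. -/
lemma exists_hom_of_isFiniteEtale [ConnectedSpace X] [ConnectedSpace P] (B : PointedScheme x)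
    (hB : IsFiniteEtale (structureMap B)) :
    ∃ A : PointedConnectedFiniteEtale x, Nonempty (A.obj ⟶ B) := by
  obtain ⟨V, i, v, hV, hi, hv⟩ := exists_connected_finiteEtale_of_point hB (point B)
  exact ⟨⟨pointedMk (i ≫ structureMap B) v (by
    rw [← Category.assoc, hv]; exact point_structureMap B), hV, hi⟩, ⟨pointedHomMk i rfl hv⟩⟩

lemma quiverIsThin_pointedConnectedFiniteEtale [Nonempty P] :
    Quiver.IsThin (PointedConnectedFiniteEtale x) := fun A B ↦ ⟨fun g h ↦
  ObjectProperty.hom_ext _ (Under.UnderMorphism.ext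
    (over_hom_ext_of_connectedSpace A.2.1 B.2.2 _ _
      ((Under.w g.hom).trans (Under.w h.hom).symm)))⟩

/-- Two members are dominated by the connected piece of their fibre product through the base point;
the condition on parallel morphisms follows from thinness. -/
lemma isCofiltered_pointedConnectedFiniteEtale [ConnectedSpace X] [ConnectedSpace P] :
    IsCofiltered (PointedConnectedFiniteEtale x) where
  nonempty := ⟨⟨pointedMk (𝟙 X) x (Category.comp_id x), inferInstanceAs (ConnectedSpace X),
    IsFiniteEtale.of_isIso (𝟙 X)⟩⟩
  cone_objs A B := by
    have h : point A.obj ≫ structureMap A.obj = point B.obj ≫ structureMap B.obj :=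
      (point_structureMap _).trans (point_structureMap _).symm
    obtain ⟨C, ⟨m⟩⟩ := exists_hom_of_isFiniteEtale (x := x)
      (pointedMk (pullback.fst (structureMap A.obj) (structureMap B.obj) ≫ structureMap A.obj)
        (pullback.lift _ _ h) (by
          rw [pullback.lift_fst_assoc]; exact point_structureMap A.obj))
      (IsFiniteEtale.comp (.of_isPullback (IsPullback.of_hasPullback _ _).flip B.2.2) A.2.2)
    exact ⟨C, ObjectProperty.homMk (m ≫ pointedHomMk (pullback.fst _ _) rfl
      (pullback.lift_fst _ _ _)), ObjectProperty.homMk (m ≫ pointedHomMk (pullback.snd _ _)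
      pullback.condition.symm (pullback.lift_snd _ _ _)), trivial⟩
  cone_maps A B g h := by
    have := quiverIsThin_pointedConnectedFiniteEtale (x := x) A B
    exact ⟨A, 𝟙 A, by rw [Subsingleton.elim g h]⟩

end Pointed

/-! ### The limit of the system and its sections -/

section Limit

attribute [local instance] IsCofiltered.isConnected isCofiltered_pointedConnectedFiniteEtale

section Existence

variable {X P : Scheme.{u}} (x : P ⟶ X) [ConnectedSpace X] [ConnectedSpace P] [CompactSpace X]

/-- The equivalence from a small model of the category of pointed connected finite étale schemes. -/
noncomputable abbrev smallModelFunctor :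
    SmallModel.{u} (PointedConnectedFiniteEtale x) ⥤ PointedConnectedFiniteEtale x :=
  (equivSmallModel.{u} (PointedConnectedFiniteEtale x)).inverse

instance isCofiltered_smallModel :
    IsCofiltered (SmallModel.{u} (PointedConnectedFiniteEtale x)) :=
  .of_equivalence (equivSmallModel _)

instance isAffineHom_diagramHom_smallModelFunctor (j) :
    IsAffineHom (diagramHom (smallModelFunctor x ⋙ finiteEtaleSystem x ⋙ Under.forget _) j) :=
  have : IsFinite (diagramHom (smallModelFunctor x ⋙ finiteEtaleSystem x ⋙ Under.forget _) j) :=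
    ((smallModelFunctor x).obj j).2.2.1
  inferInstance

instance hasLimit_finiteEtaleSystem_forget :
    HasLimit (finiteEtaleSystem x ⋙ Under.forget (Over.mk x)) :=
  have : HasLimit ((equivSmallModel.{u} (PointedConnectedFiniteEtale x)).symm.functor ⋙
      finiteEtaleSystem x ⋙ Under.forget (Over.mk x)) :=
    hasLimit_of_isAffineHom (smallModelFunctor x ⋙ finiteEtaleSystem x ⋙ Under.forget (Over.mk x))
  hasLimit_of_equivalence_comp (equivSmallModel.{u} (PointedConnectedFiniteEtale x)).symm

/-- The forgetful functor from the under category creates limits: the base points of the members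
induce that of the limit. -/
instance hasLimit_finiteEtaleSystem : HasLimit (finiteEtaleSystem x) :=
  hasLimit_of_created _ (Under.forget _)

end Existence

variable {X P : Scheme.{u}} {x : P ⟶ X} [ConnectedSpace X] [ConnectedSpace P] [CompactSpace X]
  {c : Cone (finiteEtaleSystem x)} (hc : IsLimit c)

include hc

lemma nonempty_isLimit_forget_mapCone :
    Nonempty (IsLimit ((Under.forget (Over.mk x)).mapCone c)) :=
  ⟨isLimitOfPreserves (Under.forget (Over.mk x)) hc⟩

/-- A cofiltered category is connected, and forgetting the base `X` preserves connected limits. -/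
lemma nonempty_isLimit_toScheme_mapCone : Nonempty (IsLimit ((toScheme x).mapCone c)) :=
  ⟨isLimitOfPreserves (Over.forget X) (nonempty_isLimit_forget_mapCone hc).some⟩

/-- The system itself is indexed by a large category; whiskering with the small model yields the
small diagram that the definition demands. -/
lemma isProfiniteEtale_structureMap_pt : IsProfiniteEtale (structureMap c.pt) :=
  ⟨SmallModel.{u} (PointedConnectedFiniteEtale x), inferInstance, inferInstance,
    smallModelFunctor x ⋙ finiteEtaleSystem x ⋙ Under.forget _,
    (((Under.forget (Over.mk x)).mapCone c).whisker (smallModelFunctor x)).π,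
    fun j ↦ ((smallModelFunctor x).obj j).2.2,
    ⟨(nonempty_isLimit_forget_mapCone hc).some.whiskerEquivalence
      (equivSmallModel.{u} (PointedConnectedFiniteEtale x)).symm⟩⟩

end Limit

section Limit

variable {X P : Scheme.{u}} {x : P ⟶ X} [ConnectedSpace X] [ConnectedSpace P] [CompactSpace X]
  [QuasiSeparatedSpace X]

variable (x) in
/-- The small system of connected finite étale schemes. -/
noncomputable abbrev schemeSystem :
    SmallModel.{u} (PointedConnectedFiniteEtale x) ⥤ Scheme.{u} :=
  smallModelFunctor x ⋙ finiteEtaleSystem x ⋙ toScheme x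

instance (j) : ConnectedSpace ((schemeSystem x).obj j) :=
  ((smallModelFunctor x).obj j).2.1

instance (j) : CompactSpace ((schemeSystem x).obj j) :=
  ((smallModelFunctor x).obj j).2.2.compactSpace

omit [ConnectedSpace P] [ConnectedSpace X] [CompactSpace X] [QuasiSeparatedSpace X] in
lemma isAffineHom_structureMap (A : PointedConnectedFiniteEtale x) :
    IsAffineHom (structureMap A.obj) :=
  have := A.2.2.1
  inferInstance

instance (j) : QuasiSeparatedSpace ((schemeSystem x).obj j) :=
  have := isAffineHom_structureMap ((smallModelFunctor x).obj j)
  quasiSeparatedSpace_of_quasiSeparated (structureMap ((smallModelFunctor x).obj j).obj)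

instance {i j} (φ : i ⟶ j) : IsAffineHom ((schemeSystem x).map φ) := by
  have := isAffineHom_structureMap ((smallModelFunctor x).obj i)
  have := isAffineHom_structureMap ((smallModelFunctor x).obj j)
  have h := structureMap_comp ((finiteEtaleSystem x).map ((smallModelFunctor x).map φ))
  have : IsAffineHom ((schemeSystem x).map φ ≫ structureMap ((smallModelFunctor x).obj j).obj) :=
    Eq.mpr congr(IsAffineHom $h) ‹IsAffineHom (structureMap ((smallModelFunctor x).obj i).obj)›
  exact .of_comp _ (structureMap ((smallModelFunctor x).obj j).obj)

variable {c : Cone (finiteEtaleSystem x)} (hc : IsLimit c)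

include hc

omit [QuasiSeparatedSpace X] in
lemma nonempty_isLimit_schemeSystem :
    Nonempty (IsLimit (((toScheme x).mapCone c).whisker (smallModelFunctor x))) :=
  ⟨(nonempty_isLimit_toScheme_mapCone hc).some.whiskerEquivalence
      (equivSmallModel.{u} (PointedConnectedFiniteEtale x)).symm⟩

lemma connectedSpace_pt : ConnectedSpace ((toScheme x).obj c.pt) :=
  connectedSpace_of_isLimit (schemeSystem x) (nonempty_isLimit_schemeSystem hc).some

/-- `W` is the base change of some finite étale `W'` over a member `A`. With the image of `w` as
base point, `W'` receives a pointed morphism from the limit; being over `A`, it induces the section.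
-/
lemma exists_section_through_point {W : Scheme.{u}} (p : W ⟶ (toScheme x).obj c.pt)
    (hp : IsFiniteEtale p) (w : P ⟶ W) (hw : w ≫ p = point c.pt) :
    ∃ s : (toScheme x).obj c.pt ⟶ W, s ≫ p = 𝟙 _ ∧ point c.pt ≫ s = w := by
  obtain ⟨i, W', w', q, hw', hq⟩ :=
    exists_finiteEtale_descent (schemeSystem x) (nonempty_isLimit_schemeSystem hc).some p hp
  obtain ⟨A, hA⟩ : ∃ A, A = (smallModelFunctor x).obj i := ⟨_, rfl⟩
  obtain ⟨v, hv, hq⟩ : ∃ v : W' ⟶ (toScheme x).obj A.obj, IsFiniteEtale v ∧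
      IsPullback q p v ((toScheme x).map (c.π.app A)) := by
    subst hA
    exact ⟨w', hw', hq⟩
  obtain ⟨r, hr⟩ : ∃ r, r = (toScheme x).map (c.π.app A) := ⟨_, rfl⟩
  have hrs : r ≫ structureMap A.obj = structureMap c.pt :=
    congr($hr ≫ structureMap A.obj).trans (structureMap_comp (c.π.app A))
  have hrp : point c.pt ≫ r = point A.obj :=
    congr(point c.pt ≫ $hr).trans (point_comp (c.π.app A))
  rw [← hr] at hq
  have hwqv : (w ≫ q) ≫ v = point A.obj := by
    rw [Category.assoc, hq.w, ← Category.assoc, hw, hrp]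
  let B : PointedScheme x := pointedMk (v ≫ structureMap A.obj) (w ≫ q) (by
    rw [← Category.assoc, hwqv, point_structureMap])
  let b : B ⟶ A.obj := pointedHomMk v rfl hwqv
  obtain ⟨V, ⟨m⟩⟩ := exists_hom_of_isFiniteEtale B (hv.comp A.2.2)
  let g : c.pt ⟶ B := c.π.app V ≫ m
  obtain ⟨l, hl, hlp⟩ : ∃ l : (toScheme x).obj c.pt ⟶ W', l ≫ v = r ∧ point c.pt ≫ l = w ≫ q := by
    refine ⟨(toScheme x).map g, ?_, point_comp g⟩
    -- `V ⟶ A` is a morphism of the system, so the cone identity shows that the map to `W'` lies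
    -- over the projection to `A`.
    have : c.π.app V ≫ m ≫ b = c.π.app A := c.w (ObjectProperty.homMk (m ≫ b) : V ⟶ A)
    exact congr((toScheme x).map $((Category.assoc _ _ _).trans this)).trans hr.symm
  refine ⟨hq.lift l (𝟙 _) (by rw [hl, Category.id_comp]),
    hq.lift_snd _ _ _, hq.hom_ext ?_ ?_⟩
  · rw [Category.assoc, hq.lift_fst, hlp]
  · rw [Category.assoc, hq.lift_snd, hw, Category.comp_id]

end Limit

/-! ### Universality and initiality of the limit -/

section GeometricPoint

variable {X : Scheme.{u}} [ConnectedSpace X] [CompactSpace X] [QuasiSeparatedSpace X]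
  {Ω : Type u} [Field Ω] [IsSepClosed Ω] {x : Spec (CommRingCat.of Ω) ⟶ X}
  {c : Cone (finiteEtaleSystem x)} (hc : IsLimit c)

include hc

theorem isUniversalCover_structureMap_pt : IsUniversalCover (structureMap c.pt) := by
  have := connectedSpace_pt hc
  refine ⟨isProfiniteEtale_structureMap_pt hc, this, this, fun Y f hf ↦
    isYonedaTrivial_of_isProfiniteEtale f hf fun W p hp Z _ ↦ ?_⟩
  exact bijective_of_sections_through_points (point c.pt) p hp
    (exists_section_through_point hc p hp) Z

omit [IsSepClosed Ω] in
-- Each finite étale stage of `B` receives a pointed morphism from the limit; rigidity makes these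
-- compatible with the transition maps, so they assemble to a morphism to `B`.
theorem exists_hom_of_isProfiniteEtale (B : PointedScheme x)
    (hB : IsProfiniteEtale (structureMap B)) : Nonempty (c.pt ⟶ B) := by
  have hcon := connectedSpace_pt hc
  obtain ⟨J, _, _, D, π, hD, ⟨hlim⟩⟩ := hB
  obtain ⟨y, hy⟩ : ∃ y : Over.mk x ⟶ Over.mk (structureMap B), y = B.hom := ⟨_, rfl⟩
  have key (j : J) : ∃ g : c.pt.right ⟶ D.obj j, c.pt.hom ≫ g = y ≫ π.app j := by
    obtain ⟨V, ⟨m⟩⟩ := exists_hom_of_isFiniteEtale (Under.mk (y ≫ π.app j)) (hD j)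
    exact ⟨(c.π.app V ≫ m).right, Under.w (c.π.app V ≫ m)⟩
  choose g hg using key
  let s : Cone D := ⟨c.pt.right, ⟨g, fun j k φ ↦ by
    refine (Category.id_comp _).trans (over_hom_ext_of_connectedSpace hcon (hD k) _ _ ?_)
    have hφ : π.app j ≫ D.map φ = π.app k := (π.naturality φ).symm.trans (Category.id_comp _)
    rw [hg, ← Category.assoc, hg, Category.assoc, hφ]⟩⟩
  refine ⟨Under.homMk (hlim.lift s) (Eq.trans ?_ hy)⟩
  refine hlim.hom_ext fun j ↦ (Category.assoc _ _ _).trans ?_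
  exact congr(c.pt.hom ≫ $(hlim.fac s j)).trans (hg j)

omit [IsSepClosed Ω] in
theorem nonempty_isInitial_pt (h : isPointedCover x c.pt) :
    Nonempty (IsInitial (⟨c.pt, h⟩ : PointedCover x)) :=
  ⟨IsInitial.ofUniqueHom
    (fun B ↦ ObjectProperty.homMk (exists_hom_of_isProfiniteEtale hc B.obj B.property).some)
    fun B _ ↦ ObjectProperty.hom_ext _
      (pointed_hom_ext_of_connectedSpace (connectedSpace_pt hc) B.property _ _)⟩

end GeometricPoint

lemma exists_geometricPoint (X : Scheme.{u}) [Nonempty X] :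
    ∃ (Ω : Type u) (_ : Field Ω) (_ : IsSepClosed Ω), Nonempty (Spec (CommRingCat.of Ω) ⟶ X) := by
  obtain ⟨x⟩ := (inferInstance : Nonempty X)
  exact ⟨AlgebraicClosure (X.residueField x), inferInstance, inferInstance,
    ⟨Spec.map (CommRingCat.ofHom (algebraMap (X.residueField x)
      (AlgebraicClosure (X.residueField x)))) ≫ X.fromSpecResidueField x⟩⟩

end UnivCover

theorem mainTheorem1 (X : Scheme.{u}) [ConnectedSpace X] [CompactSpace X]
    [QuasiSeparatedSpace X] :
    -- a universal cover exists
    (∃ (X' : Scheme.{u}) (p : X' ⟶ X), UnivCover.IsUniversalCover p) ∧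
    -- and, for every geometric point `x` of `X`,
    ∀ (Ω : Type u) [Field Ω] [IsSepClosed Ω] (x : Spec (CommRingCat.of Ω) ⟶ X),
      -- the pointed connected finite étale `(X, x)`-schemes form an inverse system
      -- (up to isomorphism, a directed partially ordered set)
      (EssentiallySmall.{u} (UnivCover.PointedConnectedFiniteEtale x) ∧
        Quiver.IsThin (UnivCover.PointedConnectedFiniteEtale x) ∧
        IsCofiltered (UnivCover.PointedConnectedFiniteEtale x)) ∧
      -- whose inverse limit, with its canonical geometric point,
      ∃ c : Cone (UnivCover.finiteEtaleSystem x),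
        Nonempty (IsLimit ((UnivCover.toScheme x).mapCone c)) ∧
        -- is connected and an initial object among pointed covering spaces of `(X, x)`,
        ConnectedSpace ((UnivCover.toScheme x).obj c.pt) ∧
        (∃ h : UnivCover.isPointedCover x c.pt,
          Nonempty (IsInitial (⟨c.pt, h⟩ : UnivCover.PointedCover x))) ∧
        -- and is a universal cover of `X`
        UnivCover.IsUniversalCover (UnivCover.structureMap c.pt) := by
  refine ⟨?_, fun Ω _ _ x ↦ ?_⟩
  · obtain ⟨Ω, _, _, ⟨x⟩⟩ := UnivCover.exists_geometricPoint X
    exact ⟨_, _, UnivCover.isUniversalCover_structureMap_pt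
      (limit.isLimit (UnivCover.finiteEtaleSystem x))⟩
  · have hc := limit.isLimit (UnivCover.finiteEtaleSystem x)
    exact ⟨⟨inferInstance, UnivCover.quiverIsThin_pointedConnectedFiniteEtale,
      UnivCover.isCofiltered_pointedConnectedFiniteEtale⟩, _,
      UnivCover.nonempty_isLimit_toScheme_mapCone hc, UnivCover.connectedSpace_pt hc,
      ⟨UnivCover.isProfiniteEtale_structureMap_pt hc, UnivCover.nonempty_isInitial_pt hc _⟩,
      UnivCover.isUniversalCover_structureMap_pt hc⟩
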